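/- Let $(\mu_s)_{s\in[0,1]}$ be a family of centred probability measures on $\mathbb{R}$ with finite first moments, c\`adl\`ag in $s$ for weak convergence and non-decreasing in convex order. Let $U(s,x):=-\int_{\mathbb{R}}|x-y|\,\mu_s(dy)$, and assume that the partial derivative $\partial_sU$ exists and is continuous on $[0,1]\times\mathbb{R}$ (one-sided derivatives at $s=0,1$). Let $$\mathbf{Z}:=[0,1]\times\mathbb{R}_+\times\mathbb{R},\quad \partial^p\mathbf{Z}:=\{(s,t,x)\in\mathbf{Z}: s\wedge t=0\},\quad \mathrm{int}^p(\mathbf{Z}):=\mathbf{Z}\setminus\partial^p\mathbf{Z},$$ and for $\varphi\in C^2(\mathbf{Z})$ let $$F(D\varphi,D^2\varphi):=\min\big\{\partial_t\varphi-\tfrac12\partial^2_{xx}\varphi,\ \partial_s(\varphi-U)\big\}$$ (derivatives in $s$ at $s=1$ are one-sided). Consider the variational inequality $$\min\big\{\partial_tu-\tfrac12\partial^2_{xx}u,\ \partial_s(u-U)\big\}=0\ \text{ on } \mathrm{int}^p(\mathbf{Z}),\qquad u|_{t=0}=u|_{s=0}=U(0,\cdot).$$ An upper semicontinuous $v:\mathbf{Z}\to\mathbb{R}$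 is a viscosity subsolution if $v(s,t,x)\le U(0,x)$ for all $(s,t,x)\in\partial^p\mathbf{Z}$, and $F(D\varphi,D^2\varphi)(z_0)\le 0$ for all $z_0\in\mathrm{int}^p(\mathbf{Z})$ and $\varphi\in C^2(\mathbf{Z})$ with $(v-\varphi)(z_0)=\max_{\mathbf{Z}}(v-\varphi)$. A lower semicontinuous $w:\mathbf{Z}\to\mathbb{R}$ is a viscosity supersolution if $w(s,t,x)\ge U(0,x)$ for all $(s,t,x)\in\partial^p\mathbf{Z}$, and $F(D\varphi,D^2\varphi)(z_0)\ge 0$ for all $z_0\in\mathrm{int}^p(\mathbf{Z})$ and $\varphi\in C^2(\mathbf{Z})$ with $(w-\varphi)(z_0)=\min_{\mathbf{Z}}(w-\varphi)$. **Proposition (Comparison).** Let $v$ be an upper semicontinuous viscosity subsolution and $w$ a lower semicontinuous viscosity supersolution of this variational inequality such that, for some constant $C>0$, $$v(s,t,x)\le C(1+t+|x|)\quad\text{and}\quad w(s,t,x)\ge -C(1+t+|x|)\qquad\text{for all }(s,t,x)\in\mathbf{Z}.$$ Then $v\le w$ on $\mathbf{Z}$. -/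

import Mathlib

open Set Filter Topology MeasureTheory

noncomputable section

/-- A family `(μ_s)_{s ∈ [0,1]}` of centred probability measures on `ℝ` with finite first moment,
càdlàg for the weak convergence of measures and non-decreasing in convex order. Only the values
at `s ∈ [0,1]` matter. -/
structure IsMarginalFamily (μ : ℝ → ProbabilityMeasure ℝ) : Prop where
  integrable_id : ∀ s ∈ Icc (0 : ℝ) 1, Integrable (fun y : ℝ => y) (μ s : Measure ℝ)
  centred : ∀ s ∈ Icc (0 : ℝ) 1, ∫ y, y ∂(μ s : Measure ℝ) = 0
  right_continuous : ∀ s ∈ Ico (0 : ℝ) 1, ContinuousWithinAt μ (Icc s 1) s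
  left_limit : ∀ s ∈ Ioc (0 : ℝ) 1, ∃ ν : ProbabilityMeasure ℝ, Tendsto μ (𝓝[Ico 0 s] s) (𝓝 ν)
  /-- The integral of a convex function is well defined in `(-∞, ∞]`, so the inequality of the
  convex order says nothing when the right-hand side is infinite, and otherwise both sides are
  finite. -/
  convex_order : ∀ φ : ℝ → ℝ, ConvexOn ℝ univ φ → ∀ s ∈ Icc (0 : ℝ) 1, ∀ t ∈ Icc (0 : ℝ) 1,
    s ≤ t → Integrable φ (μ t : Measure ℝ) →
      Integrable φ (μ s : Measure ℝ) ∧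
        ∫ y, φ y ∂(μ s : Measure ℝ) ≤ ∫ y, φ y ∂(μ t : Measure ℝ)

/-- The potential function `U(s,x) = -∫ |x - y| μ_s(dy)`. -/
def potential (μ : ℝ → ProbabilityMeasure ℝ) (s x : ℝ) : ℝ :=
  -∫ y, |x - y| ∂(μ s : Measure ℝ)

/-- The partial derivative `∂_s U(s,x)` for `s ∈ [0,1]` (one-sided at the end points). -/
def potentialDs (μ : ℝ → ProbabilityMeasure ℝ) (s x : ℝ) : ℝ :=
  derivWithin (fun r => potential μ r x) (Icc 0 1) s

/-- `∂_s U` exists and is continuous on `[0,1] × ℝ`. -/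
def PotentialRegular (μ : ℝ → ProbabilityMeasure ℝ) : Prop :=
  (∀ s ∈ Icc (0 : ℝ) 1, ∀ x : ℝ,
    DifferentiableWithinAt ℝ (fun r => potential μ r x) (Icc 0 1) s) ∧
  ContinuousOn (fun p : ℝ × ℝ => potentialDs μ p.1 p.2) (Icc 0 1 ×ˢ univ)

/-- The domain `Z = [0,1] × ℝ₊ × ℝ`, with points `z = (s, t, x)`. -/
def domainZ : Set (ℝ × ℝ × ℝ) := Icc 0 1 ×ˢ Ici 0 ×ˢ univ

/-- The parabolic boundary `{(s,t,x) ∈ Z : min s t = 0}`. -/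
def parabolicBoundary : Set (ℝ × ℝ × ℝ) := {z ∈ domainZ | min z.1 z.2.1 = 0}

/-- The parabolic interior of `Z`. -/
def parabolicInterior : Set (ℝ × ℝ × ℝ) := domainZ \ parabolicBoundary

/-- `F(Dφ, D²φ) = min {∂_t φ - ½ ∂²_{xx} φ, ∂_s φ - ∂_s U}`, with partial derivatives taken
within `Z`. -/
def pdeOperator (μ : ℝ → ProbabilityMeasure ℝ) (φ : ℝ × ℝ × ℝ → ℝ) (z : ℝ × ℝ × ℝ) : ℝ :=
  min
    (derivWithin (fun r => φ (z.1, r, z.2.2)) (Ici 0) z.2.1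
      - (1 / 2) * iteratedDeriv 2 (fun y => φ (z.1, z.2.1, y)) z.2.2)
    (derivWithin (fun r => φ (r, z.2.1, z.2.2)) (Icc 0 1) z.1 - potentialDs μ z.1 z.2.2)

/-- Upper semicontinuous viscosity subsolutions on `Z` of `min {∂_t u - ½ ∂²_{xx} u, ∂_s (u - U)} = 0`
with boundary values `U(0,·)`. -/
structure IsViscositySubsolution (μ : ℝ → ProbabilityMeasure ℝ) (v : ℝ × ℝ × ℝ → ℝ) : Prop where
  usc : UpperSemicontinuousOn v domainZ
  boundary : ∀ z ∈ parabolicBoundary, v z ≤ potential μ 0 z.2.2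
  interior : ∀ z₀ ∈ parabolicInterior, ∀ φ : ℝ × ℝ × ℝ → ℝ, ContDiffOn ℝ 2 φ domainZ →
    IsMaxOn (fun z => v z - φ z) domainZ z₀ → pdeOperator μ φ z₀ ≤ 0

/-- Lower semicontinuous viscosity supersolutions on `Z` of
`min {∂_t u - ½ ∂²_{xx} u, ∂_s (u - U)} = 0` with boundary values `U(0,·)`. -/
structure IsViscositySupersolution (μ : ℝ → ProbabilityMeasure ℝ) (w : ℝ × ℝ × ℝ → ℝ) : Prop where
  lsc : LowerSemicontinuousOn w domainZ
  boundary : ∀ z ∈ parabolicBoundary, potential μ 0 z.2.2 ≤ w z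
  interior : ∀ z₀ ∈ parabolicInterior, ∀ φ : ℝ × ℝ × ℝ → ℝ, ContDiffOn ℝ 2 φ domainZ →
    IsMinOn (fun z => w z - φ z) domainZ z₀ → 0 ≤ pdeOperator μ φ z₀

end

/-!
The nonlinear operator is a minimum of two *linear* expressions, and a supersolution makes both of
them non-negative. The set of such functions is therefore convex and, up to the variation of `∂_s U`,
stable under averaging of translates, so a supersolution `w` can be replaced by smooth ones obtained
by convolution. A smooth approximate supersolution is an admissible test function for the
subsolution `v`, so the comparison reduces to the maximum principle; neither a doubling of variables
nor a lemma on the second derivatives of semicontinuous functions is needed.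

To make sense of the averaging, the viscosity inequalities for `w` are first turned into inequalities
without derivatives, by comparison with smooth barriers (which may be taken local, see
`IsViscositySupersolution.pdeOperator_nonneg_of_local`):

* `w - U` is non-decreasing in `s` (`IsViscositySupersolution.sub_potential_mono`);
* at fixed `s`, `w` dominates its Gaussian averages, `w(s, t + h, x) ≥ E w(s, t, x + √h Z)`
  (`IsViscositySupersolution.heatAverage_min_le`). Here `w` is truncated from above by a quadratic
  solution of the heat equation, which gives integrability without destroying the inequality.

Both inequalities survive when `w` is continued by the boundary datum `U(0,·)` to `s ≤ 0` and
`t ≤ 0` (`pastExtension`), because `w` dominates that datum on the boundary and `U` is concave in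
`x` and non-increasing in `s`. Convolution with kernels that only look to the past preserves them, and for smooth functions they become the pointwise
differential inequalities (`IsPastMollifier.iteratedDeriv_mollify_le`,
`IsPastMollifier.le_deriv_mollify`). Since `w` is only semicontinuous, convergence of the
mollifications at a *given* point is not automatic. It is enough that they do not exceed `w` there in
the limit, which holds if the kernel is a cut-off heat kernel, again by the two inequalities above
(`exists_isPastMollifier_mollify_le`).

With a small coercive penalty added, these mollifications contradict the subsolution property at a
positive maximum of the difference with `v`.
-/

/-! ### The potential function -/

section Potential

variable {μ : ℝ → ProbabilityMeasure ℝ}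

lemma IsMarginalFamily.integrable_abs_sub (hμ : IsMarginalFamily μ) {s : ℝ}
    (hs : s ∈ Icc (0 : ℝ) 1) (x : ℝ) : Integrable (fun y => |x - y|) (μ s : Measure ℝ) :=
  ((integrable_const x).sub (hμ.integrable_id s hs)).abs

lemma potential_nonpos (s x : ℝ) : potential μ s x ≤ 0 :=
  neg_nonpos.2 (integral_nonneg fun _ => abs_nonneg _)

lemma IsMarginalFamily.abs_potential_sub_le (hμ : IsMarginalFamily μ) {s : ℝ}
    (hs : s ∈ Icc (0 : ℝ) 1) (x y : ℝ) : |potential μ s x - potential μ s y| ≤ |x - y| := by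
  have h : ∀ x y, potential μ s x ≤ potential μ s y + |x - y| := by
    intro x y
    have h1 : ∫ a, |y - a| ∂(μ s : Measure ℝ) ≤ ∫ a, (|x - a| + |x - y|) ∂(μ s : Measure ℝ) := by
      refine integral_mono (hμ.integrable_abs_sub hs y)
        ((hμ.integrable_abs_sub hs x).add (integrable_const _)) fun a => ?_
      have := abs_sub_le y x a
      rw [abs_sub_comm y x] at this
      simp only
      linarith
    rw [integral_add (hμ.integrable_abs_sub hs x) (integrable_const _)] at h1
    simp only [integral_const, probReal_univ, one_smul] at h1
    unfold potential
    linarith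
  rw [abs_le]
  have h1 := h x y
  have h2 := h y x
  rw [abs_sub_comm y x] at h2
  constructor <;> linarith

lemma IsMarginalFamily.continuous_potential (hμ : IsMarginalFamily μ) {s : ℝ}
    (hs : s ∈ Icc (0 : ℝ) 1) : Continuous (potential μ s) :=
  (LipschitzWith.of_dist_le_mul (K := 1) fun x y => by
    simpa [Real.dist_eq] using hμ.abs_potential_sub_le hs x y).continuous

lemma IsMarginalFamily.concaveOn_potential (hμ : IsMarginalFamily μ) {s : ℝ}
    (hs : s ∈ Icc (0 : ℝ) 1) : ConcaveOn ℝ univ (potential μ s) := by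
  refine ⟨convex_univ, fun x _ y _ a b ha hb hab => ?_⟩
  have h1 : ∫ c, |(a • x + b • y) - c| ∂(μ s : Measure ℝ)
      ≤ ∫ c, (a * |x - c| + b * |y - c|) ∂(μ s : Measure ℝ) := by
    refine integral_mono (hμ.integrable_abs_sub hs _)
      (((hμ.integrable_abs_sub hs x).const_mul a).add ((hμ.integrable_abs_sub hs y).const_mul b))
      fun c => ?_
    have : (a • x + b • y) - c = a * (x - c) + b * (y - c) := by
      simp only [smul_eq_mul]
      linear_combination c * hab
    simp only [this]
    refine (abs_add_le _ _).trans_eq ?_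
    rw [abs_mul, abs_mul, abs_of_nonneg ha, abs_of_nonneg hb]
  rw [integral_add ((hμ.integrable_abs_sub hs x).const_mul a)
    ((hμ.integrable_abs_sub hs y).const_mul b), integral_const_mul, integral_const_mul] at h1
  simp only [potential, smul_eq_mul] at h1 ⊢
  linarith

lemma IsMarginalFamily.antitoneOn_potential (hμ : IsMarginalFamily μ) (x : ℝ) :
    AntitoneOn (fun s => potential μ s x) (Icc 0 1) := by
  intro s hs t ht hst
  have hconv : ConvexOn ℝ univ (fun y : ℝ => |x - y|) := by
    refine ⟨convex_univ, fun y _ z _ a b ha hb hab => ?_⟩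
    have : x - (a • y + b • z) = a * (x - y) + b * (x - z) := by
      simp only [smul_eq_mul]
      linear_combination (-x) * hab
    simp only [this]
    refine (abs_add_le _ _).trans_eq ?_
    rw [abs_mul, abs_mul, abs_of_nonneg ha, abs_of_nonneg hb, smul_eq_mul, smul_eq_mul]
  exact neg_le_neg
    (hμ.convex_order _ hconv s hs t ht hst (hμ.integrable_abs_sub ht x)).2

lemma IsMarginalFamily.potentialDs_nonpos (hμ : IsMarginalFamily μ) (s x : ℝ) :
    potentialDs μ s x ≤ 0 :=
  (hμ.antitoneOn_potential x).derivWithin_nonpos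

lemma IsMarginalFamily.exists_le_potential_zero (hμ : IsMarginalFamily μ) :
    ∃ m : ℝ, 0 ≤ m ∧ ∀ x, -(m + |x|) ≤ potential μ 0 x := by
  refine ⟨-potential μ 0 0, neg_nonneg.2 (potential_nonpos _ _), fun x => ?_⟩
  have h := neg_le_of_abs_le (hμ.abs_potential_sub_le (s := 0) ⟨le_rfl, zero_le_one⟩ x 0)
  rw [sub_zero] at h
  linarith

end Potential

/-! ### Evaluating and localising the operator -/

section Operator

variable {μ : ℝ → ProbabilityMeasure ℝ}

lemma mem_domainZ {s t x : ℝ} : (s, t, x) ∈ domainZ ↔ (0 ≤ s ∧ s ≤ 1) ∧ 0 ≤ t := by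
  simp [domainZ]

lemma mem_parabolicInterior {s t x : ℝ} :
    (s, t, x) ∈ parabolicInterior ↔ (0 < s ∧ s ≤ 1) ∧ 0 < t := by
  simp only [parabolicInterior, parabolicBoundary, Set.mem_sdiff, mem_ofPred_eq, mem_domainZ, not_and]
  constructor
  · rintro ⟨⟨⟨h0, h1⟩, ht⟩, h⟩
    have h := h ⟨⟨h0, h1⟩, ht⟩
    refine ⟨⟨lt_of_le_of_ne h0 ?_, h1⟩, lt_of_le_of_ne ht ?_⟩
    · rintro rfl
      exact h (min_eq_left ht)
    · rintro rfl
      exact h (min_eq_right h0)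
  · rintro ⟨⟨h0, h1⟩, ht⟩
    exact ⟨⟨⟨h0.le, h1⟩, ht.le⟩, fun _ => (lt_min h0 ht).ne'⟩

lemma mem_parabolicBoundary {s t x : ℝ} (h : (s, t, x) ∈ domainZ) :
    (s, t, x) ∈ parabolicBoundary ↔ s = 0 ∨ t = 0 := by
  have h' := mem_domainZ.1 h
  simp only [parabolicBoundary, mem_ofPred_eq, h, true_and]
  constructor
  · intro h0
    rcases min_choice s t with h1 | h1
    · exact Or.inl (h1.symm.trans h0)
    · exact Or.inr (h1.symm.trans h0)
  · rintro (rfl | rfl)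
    · exact min_eq_left h'.2
    · exact min_eq_right h'.1.1

lemma iteratedDeriv_two_eq {g g' : ℝ → ℝ} {c x : ℝ} (h : ∀ y, HasDerivAt g (g' y) y)
    (h' : HasDerivAt g' c x) : iteratedDeriv 2 g x = c := by
  rw [iteratedDeriv_succ, iteratedDeriv_one, funext fun y => (h y).deriv]
  exact h'.deriv

lemma pdeOperator_eq {φ : ℝ × ℝ × ℝ → ℝ} {s t x a b : ℝ} (hz : (s, t, x) ∈ domainZ)
    (ht : HasDerivAt (fun r => φ (s, r, x)) a t) (hs : HasDerivAt (fun r => φ (r, t, x)) b s) :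
    pdeOperator μ φ (s, t, x) =
      min (a - 1 / 2 * iteratedDeriv 2 (fun y => φ (s, t, y)) x) (b - potentialDs μ s x) := by
  have h := mem_domainZ.1 hz
  unfold pdeOperator
  simp only
  rw [ht.hasDerivWithinAt.derivWithin (uniqueDiffOn_Ici 0 t h.2),
    hs.hasDerivWithinAt.derivWithin (uniqueDiffOn_Icc zero_lt_one s h.1)]

lemma pdeOperator_congr {φ ψ : ℝ × ℝ × ℝ → ℝ} {z : ℝ × ℝ × ℝ} (h : φ =ᶠ[𝓝 z] ψ) :
    pdeOperator μ φ z = pdeOperator μ ψ z := by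
  obtain ⟨s, t, x⟩ := z
  have h1 : (fun r => φ (s, r, x)) =ᶠ[𝓝 t] fun r => ψ (s, r, x) :=
    ((by fun_prop : Continuous fun r : ℝ => (s, r, x)).tendsto t).eventually h
  have h2 : (fun r => φ (r, t, x)) =ᶠ[𝓝 s] fun r => ψ (r, t, x) :=
    ((by fun_prop : Continuous fun r : ℝ => (r, t, x)).tendsto s).eventually h
  have h3 : (fun r => φ (s, t, r)) =ᶠ[𝓝 x] fun r => ψ (s, t, r) :=
    ((by fun_prop : Continuous fun r : ℝ => (s, t, r)).tendsto x).eventually h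
  unfold pdeOperator
  simp only
  rw [(h1.filter_mono nhdsWithin_le_nhds).derivWithin_eq h1.eq_of_nhds,
    (h2.filter_mono nhdsWithin_le_nhds).derivWithin_eq h2.eq_of_nhds, h3.iteratedDeriv_eq]

/-- A supersolution of linear growth may be tested with functions that are `C²` near the contact
point only and touch locally: away from the contact point the test function is glued to a smooth
function lying far below `w`. -/
lemma IsViscositySupersolution.pdeOperator_nonneg_of_local {w : ℝ × ℝ × ℝ → ℝ}
    (hw : IsViscositySupersolution μ w) {C : ℝ} (hC : 0 < C)
    (hwC : ∀ z ∈ domainZ, -(C * (1 + z.2.1 + |z.2.2|)) ≤ w z)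
    {z₀ : ℝ × ℝ × ℝ} (hz₀ : z₀ ∈ parabolicInterior) {φ : ℝ × ℝ × ℝ → ℝ}
    (hφ : ContDiffAt ℝ 2 φ z₀) (hmin : ∀ᶠ z in 𝓝 z₀, z ∈ domainZ → w z₀ - φ z₀ ≤ w z - φ z) :
    0 ≤ pdeOperator μ φ z₀ := by
  obtain ⟨u, hu, hφu⟩ := hφ.contDiffOn le_rfl (by simp)
  obtain ⟨R, hR, hRu⟩ := Metric.mem_nhds_iff.1 (inter_mem hu hmin)
  let χ : ContDiffBump z₀ := ⟨R / 4, R / 2, by positivity, by linarith⟩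
  set m := w z₀ - φ z₀ with hm
  set g : ℝ × ℝ × ℝ → ℝ := fun z => -(C * (2 + z.2.1 + z.2.2 ^ 2)) - m with hg
  have hgC : ContDiff ℝ 2 g := by fun_prop
  have hwg : ∀ z ∈ domainZ, m ≤ w z - g z := by
    intro z hz
    have h1 := hwC z hz
    have h2 : |z.2.2| ≤ 1 + z.2.2 ^ 2 := by
      nlinarith [sq_nonneg (|z.2.2| - 1), sq_abs z.2.2, abs_nonneg z.2.2]
    have h3 : C * (1 + z.2.1 + |z.2.2|) ≤ C * (2 + z.2.1 + z.2.2 ^ 2) :=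
      mul_le_mul_of_nonneg_left (by linarith) hC.le
    simp only [hg]
    linarith
  set ψ : ℝ × ℝ × ℝ → ℝ := fun z => g z + χ z * (φ z - g z) with hψ
  have hψC : ContDiff ℝ 2 ψ := by
    refine hgC.add (contDiff_iff_contDiffAt.2 fun z => ?_)
    by_cases hz : z ∈ Metric.ball z₀ R
    · have h1 : ContDiffAt ℝ 2 φ z :=
        (hφu.mono fun y hy => (hRu hy).1).contDiffAt (Metric.isOpen_ball.mem_nhds hz)
      exact χ.contDiff.contDiffAt.mul (h1.sub hgC.contDiffAt)
    · have hz' : z ∈ (Metric.closedBall z₀ (R / 2))ᶜ := by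
        simp only [Metric.mem_ball, not_lt, mem_compl_iff, Metric.mem_closedBall, not_le] at hz ⊢
        linarith
      have h0 : (fun z => χ z * (φ z - g z)) =ᶠ[𝓝 z] fun _ => 0 := by
        filter_upwards [Metric.isClosed_closedBall.isOpen_compl.mem_nhds hz'] with y hy
        have : χ y = 0 := χ.zero_of_le_dist (by
          simp only [mem_compl_iff, Metric.mem_closedBall, not_le] at hy
          exact hy.le)
        rw [this, zero_mul]
      exact contDiffAt_const.congr_of_eventuallyEq h0
  have hψφ : ψ =ᶠ[𝓝 z₀] φ := by
    filter_upwards [χ.eventuallyEq_one] with z hz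
    simp only [hψ, hz, Pi.one_apply]
    ring
  rw [← pdeOperator_congr hψφ]
  refine hw.interior z₀ hz₀ ψ hψC.contDiffOn fun z hz => ?_
  simp only [mem_ofPred_eq]
  rw [hψφ.eq_of_nhds, ← hm]
  have e : w z - ψ z = χ z * (w z - φ z) + (1 - χ z) * (w z - g z) := by
    simp only [hψ]
    ring
  rw [e]
  have h2 : (1 - χ z) * m ≤ (1 - χ z) * (w z - g z) :=
    mul_le_mul_of_nonneg_left (hwg z hz) (sub_nonneg.2 χ.le_one)
  have h1 : χ z * m ≤ χ z * (w z - φ z) := by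
    by_cases hzR : z ∈ Metric.ball z₀ R
    · exact mul_le_mul_of_nonneg_left ((hRu hzR).2 hz) χ.nonneg
    · have : χ z = 0 := χ.zero_of_le_dist (by
        simp only [Metric.mem_ball, not_lt] at hzR
        have : R / 2 ≤ R := by linarith
        exact this.trans hzR)
      rw [this, zero_mul, zero_mul]
  linarith

end Operator

/-! ### Supersolutions minus the potential are non-decreasing in `s` -/

section MonotoneInS

variable {μ : ℝ → ProbabilityMeasure ℝ}

/-- Comparison with a barrier: a function `ψ` of `s` alone whose slope stays below `∂_s U` near
`x₀` gives a lower bound for the growth of a supersolution in `s`. -/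
lemma IsViscositySupersolution.add_le_of_deriv_lt {w : ℝ × ℝ × ℝ → ℝ}
    (hw : IsViscositySupersolution μ w) {C : ℝ} (hC : 0 < C)
    (hwC : ∀ z ∈ domainZ, -(C * (1 + z.2.1 + |z.2.2|)) ≤ w z)
    {s₁ s₂ t₀ x₀ r : ℝ} (h0 : 0 ≤ s₁) (h12 : s₁ ≤ s₂) (h2 : s₂ ≤ 1) (ht₀ : 0 < t₀) (hr : 0 < r)
    {ψ : ℝ → ℝ} (hψ : ContDiff ℝ 2 ψ) (hψ1 : ψ s₁ = 0)
    (hψd : ∀ s ∈ Icc (0 : ℝ) 1, ∀ x, |x - x₀| ≤ r → deriv ψ s < potentialDs μ s x) :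
    w (s₁, t₀, x₀) + ψ s₂ ≤ w (s₂, t₀, x₀) := by
  rw [← le_sub_iff_add_le]
  refine le_of_forall_lt_imp_le_of_dense fun a ha => ?_
  by_contra hcon
  push Not at hcon
  obtain ⟨M, hM⟩ : ∃ M, ∀ s ∈ Icc (0 : ℝ) 1, |ψ s| ≤ M := by
    obtain ⟨M, hM⟩ := isCompact_Icc.exists_bound_of_continuousOn
      (hψ.continuous.continuousOn (s := Icc (0 : ℝ) 1))
    exact ⟨M, fun s hs => hM s hs⟩
  have hM0 : 0 ≤ M := (abs_nonneg _).trans (hM 0 (by simp))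
  have hz1 : (s₁, t₀, x₀) ∈ domainZ := mem_domainZ.2 ⟨⟨h0, h12.trans h2⟩, ht₀.le⟩
  obtain ⟨ρ, hρ, hρw⟩ := Metric.mem_nhdsWithin_iff.1 (hw.lsc _ hz1 a ha)
  obtain ⟨r₀, hr₀, hr₀ρ, hr₀r, hr₀t⟩ : ∃ r₀ > 0, r₀ < ρ ∧ r₀ ≤ r ∧ r₀ < t₀ :=
    ⟨min (ρ / 2) (min r (t₀ / 2)), by positivity,
      (min_le_left _ _).trans_lt (by linarith), (min_le_right _ _).trans (min_le_left _ _),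
      (min_le_right _ _).trans_lt ((min_le_right _ _).trans_lt (by linarith))⟩
  set K₀ := 3 + t₀ + |x₀| with hK₀
  have hK₀0 : 0 ≤ K₀ := by positivity
  set n := C + (|a| + M + C * K₀) / r₀ ^ 2 with hn
  have hn0 : 0 ≤ n := by positivity
  set q : ℝ × ℝ × ℝ → ℝ := fun z => (z.2.1 - t₀) ^ 2 + (z.2.2 - x₀) ^ 2 with hq
  -- far from `(t₀, x₀)` the quadratic penalty beats the linear growth of `w`
  have hfar : ∀ z ∈ domainZ, r₀ ^ 2 ≤ q z → a + M - n * q z ≤ w z := by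
    intro z hz hqz
    have e1 : n * q z ≥ C * q z + (|a| + M + C * K₀) := by
      have : (|a| + M + C * K₀) / r₀ ^ 2 * q z ≥ (|a| + M + C * K₀) / r₀ ^ 2 * r₀ ^ 2 :=
        mul_le_mul_of_nonneg_left hqz (by positivity)
      rw [div_mul_cancel₀ _ (by positivity)] at this
      rw [hn, add_mul]
      linarith
    have e2 : 1 + z.2.1 + |z.2.2| ≤ K₀ + q z := by
      have f1 : z.2.1 - t₀ ≤ 1 + (z.2.1 - t₀) ^ 2 := by nlinarith [sq_nonneg (z.2.1 - t₀ - 1)]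
      have f2 : |z.2.2| ≤ |x₀| + |z.2.2 - x₀| := by
        have := abs_add_le x₀ (z.2.2 - x₀)
        rwa [add_sub_cancel] at this
      have f3 : |z.2.2 - x₀| ≤ 1 + (z.2.2 - x₀) ^ 2 := by
        nlinarith [sq_nonneg (|z.2.2 - x₀| - 1), sq_abs (z.2.2 - x₀), abs_nonneg (z.2.2 - x₀)]
      simp only [hq, hK₀]
      linarith
    have e3 := mul_le_mul_of_nonneg_left e2 hC.le
    have e4 := hwC z hz
    have e5 := le_abs_self a
    rw [mul_add] at e3
    linarith
  have hinit : ∀ t x, 0 ≤ t → a - n * q (s₁, t, x) ≤ w (s₁, t, x) := by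
    intro t x ht
    have hz : (s₁, t, x) ∈ domainZ := mem_domainZ.2 ⟨⟨h0, h12.trans h2⟩, ht⟩
    rcases le_or_gt (r₀ ^ 2) (q (s₁, t, x)) with h | h
    · have := hfar _ hz h
      linarith
    · have hb : |t - t₀| < r₀ := abs_lt_of_sq_lt_sq (by
        simp only [hq] at h
        nlinarith [sq_nonneg (x - x₀)]) hr₀.le
      have hb' : |x - x₀| < r₀ := abs_lt_of_sq_lt_sq (by
        simp only [hq] at h
        nlinarith [sq_nonneg (t - t₀)]) hr₀.le
      have hmem : (s₁, t, x) ∈ Metric.ball (s₁, t₀, x₀) ρ := by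
        simp only [Metric.mem_ball, Prod.dist_eq, dist_self, Real.dist_eq]
        exact max_lt hρ (max_lt (hb.trans hr₀ρ) (hb'.trans hr₀ρ))
      have h3 : a < w (s₁, t, x) := hρw ⟨hmem, hz⟩
      have h4 : 0 ≤ n * q (s₁, t, x) := mul_nonneg hn0 (by simp only [hq]; positivity)
      linarith
  set φ : ℝ × ℝ × ℝ → ℝ := fun z => a + ψ z.1 - n * q z with hφ
  have hφC : ContDiff ℝ 2 φ := by
    simp only [hφ, hq]
    fun_prop
  set K : Set (ℝ × ℝ × ℝ) := Icc s₁ 1 ×ˢ Icc (t₀ - r₀) (t₀ + r₀) ×ˢ Icc (x₀ - r₀) (x₀ + r₀) with hK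
  have hKc : IsCompact K := isCompact_Icc.prod (isCompact_Icc.prod isCompact_Icc)
  have hKZ : K ⊆ domainZ := by
    rintro ⟨s, t, x⟩ ⟨hs, ht, -⟩
    exact mem_domainZ.2 ⟨⟨h0.trans hs.1, hs.2⟩, by have := ht.1; simp only at this; linarith⟩
  have hz2 : (s₂, t₀, x₀) ∈ K := ⟨⟨h12, h2⟩, ⟨by linarith, by linarith⟩, by
    constructor <;> simp only <;> linarith⟩
  obtain ⟨⟨s, t, x⟩, hzK, hzmin⟩ := LowerSemicontinuousOn.exists_isMinOn (f := fun z => w z - φ z)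
    ⟨_, hz2⟩ hKc (by
      simp only [sub_eq_add_neg]
      exact (hw.lsc.mono hKZ).add hφC.continuous.neg.continuousOn.lowerSemicontinuousOn)
  have hzmin := isMinOn_iff.1 hzmin
  have hneg : w (s, t, x) - φ (s, t, x) < 0 := by
    refine (hzmin _ hz2).trans_lt ?_
    simp only [hφ, hq]
    simp
    linarith
  have hzZ := hKZ hzK
  have hs01 := (mem_domainZ.1 hzZ).1
  have hqlt : q (s, t, x) < r₀ ^ 2 := by
    by_contra h
    have e1 := hfar _ hzZ (not_lt.1 h)
    have e2 := le_of_abs_le (hM s hs01)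
    simp only [hφ] at hneg
    linarith
  have hb : |t - t₀| < r₀ := abs_lt_of_sq_lt_sq (by
    simp only [hq] at hqlt
    nlinarith [sq_nonneg (x - x₀)]) hr₀.le
  have hb' : |x - x₀| < r₀ := abs_lt_of_sq_lt_sq (by
    simp only [hq] at hqlt
    nlinarith [sq_nonneg (t - t₀)]) hr₀.le
  -- by the initial inequality the minimum is not attained at `s = s₁`; it may be at `s = 1`, where
  -- the one-sided test is legitimate
  have hs1 : s₁ < s := by
    rcases hzK.1.1.eq_or_lt with h | h
    · exfalso
      simp only at h
      subst h
      have := hinit t x (mem_domainZ.1 hzZ).2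
      simp only [hφ, hψ1] at hneg
      linarith
    · exact h
  have ht : 0 < t := by
    have := (abs_lt.1 hb).1
    linarith
  have hpde := hw.pdeOperator_nonneg_of_local hC hwC (z₀ := (s, t, x))
    (mem_parabolicInterior.2 ⟨⟨h0.trans_lt hs1, hs01.2⟩, ht⟩) hφC.contDiffAt (by
      have hU : Ioi s₁ ×ˢ {t | |t - t₀| < r₀} ×ˢ {x | |x - x₀| < r₀} ∈ 𝓝 (s, t, x) := by
        refine prod_mem_nhds (Ioi_mem_nhds hs1) (prod_mem_nhds ?_ ?_)
        · exact (isOpen_lt (by fun_prop) continuous_const).mem_nhds hb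
        · exact (isOpen_lt (by fun_prop) continuous_const).mem_nhds hb'
      filter_upwards [hU]
      rintro ⟨s', t', x'⟩ ⟨h1, h2, h3⟩ hZ
      refine hzmin _ ⟨⟨le_of_lt h1, (mem_domainZ.1 hZ).1.2⟩, ?_, ?_⟩
      · have := abs_lt.1 (show |t' - t₀| < r₀ from h2)
        constructor <;> simp only <;> linarith
      · have := abs_lt.1 (show |x' - x₀| < r₀ from h3)
        constructor <;> simp only <;> linarith)
  have hdt : HasDerivAt (fun r => φ (s, r, x)) (-(n * (2 * (t - t₀)))) t := by
    have h1 : HasDerivAt (fun r : ℝ => (r - t₀) ^ 2) (2 * (t - t₀)) t := by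
      simpa using ((hasDerivAt_id t).sub_const t₀).fun_pow 2
    simpa [hφ, hq] using ((h1.add_const ((x - x₀) ^ 2)).const_mul n).const_sub (a + ψ s)
  have hds : HasDerivAt (fun r => φ (r, t, x)) (deriv ψ s) s := by
    have h1 : HasDerivAt ψ (deriv ψ s) s :=
      (hψ.differentiable (by simp)).differentiableAt.hasDerivAt
    simpa [hφ, hq] using (h1.const_add a).sub_const (n * ((t - t₀) ^ 2 + (x - x₀) ^ 2))
  rw [pdeOperator_eq hzZ hdt hds] at hpde
  have := (le_min_iff.1 hpde).2
  have := hψd s hs01 x (hb'.le.trans hr₀r)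
  linarith

/-- `w - U` is non-decreasing in `s`. -/
lemma IsViscositySupersolution.sub_potential_mono {w : ℝ × ℝ × ℝ → ℝ}
    (hw : IsViscositySupersolution μ w) (hU : PotentialRegular μ) {C : ℝ} (hC : 0 < C)
    (hwC : ∀ z ∈ domainZ, -(C * (1 + z.2.1 + |z.2.2|)) ≤ w z)
    {s₁ s₂ t₀ : ℝ} (x₀ : ℝ) (h0 : 0 ≤ s₁) (h12 : s₁ ≤ s₂) (h2 : s₂ ≤ 1) (ht₀ : 0 < t₀) :
    w (s₁, t₀, x₀) - potential μ s₁ x₀ ≤ w (s₂, t₀, x₀) - potential μ s₂ x₀ := by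
  have key : ∀ η > 0, w (s₁, t₀, x₀) + (potential μ s₂ x₀ - potential μ s₁ x₀ - 3 * η)
      ≤ w (s₂, t₀, x₀) := by
    intro η hη
    have hcompact : IsCompact (Icc (0 : ℝ) 1 ×ˢ Icc (x₀ - 1) (x₀ + 1)) :=
      isCompact_Icc.prod isCompact_Icc
    have huc := hcompact.uniformContinuousOn_of_continuous
      (hU.2.mono (prod_mono_right (subset_univ _)))
    obtain ⟨r, hr, hru⟩ := Metric.uniformContinuousOn_iff.1 huc η hη
    have hcont : ContinuousOn (fun s => potentialDs μ s x₀) (Icc 0 1) :=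
      hU.2.comp (f := fun s : ℝ => (s, x₀)) (by fun_prop) fun s hs => ⟨hs, mem_univ _⟩
    -- the barrier is an antiderivative of a polynomial close to `∂_s U(·, x₀)`, lowered by `2 η`
    obtain ⟨q, hq⟩ := exists_polynomial_near_of_continuousOn 0 1 _ hcont η hη
    have hqc : Continuous fun r => q.eval r - 2 * η := by fun_prop
    set ψ : ℝ → ℝ := fun s => ∫ r in s₁..s, (q.eval r - 2 * η) with hψ
    have hψd : ∀ s, HasDerivAt ψ (q.eval s - 2 * η) s := fun s =>
      intervalIntegral.integral_hasDerivAt_right (hqc.intervalIntegrable _ _)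
        (hqc.stronglyMeasurableAtFilter _ _) hqc.continuousAt
    have hψd' : deriv ψ = fun s => q.eval s - 2 * η := funext fun s => (hψd s).deriv
    have hψC : ContDiff ℝ 2 ψ := by
      rw [show (2 : WithTop ℕ∞) = 1 + 1 from rfl, contDiff_succ_iff_deriv]
      refine ⟨fun s => (hψd s).differentiableAt, by simp, ?_⟩
      rw [hψd']
      exact (q.contDiff_aeval 1).sub contDiff_const
    have hψ1 : ψ s₁ = 0 := by simp [hψ]
    have hbar := hw.add_le_of_deriv_lt hC hwC h0 h12 h2 ht₀ (x₀ := x₀) (r := min (r / 2) 1)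
      (by positivity) hψC hψ1 (by
        intro s hs x hx
        rw [hψd']
        have e1 := (abs_lt.1 (hq s hs)).2
        have hx1 := hx.trans (min_le_right _ _)
        have hx2 := hx.trans (min_le_left _ _)
        have e2 := hru (s, x) ⟨hs, by
          have := abs_le.1 hx1
          constructor <;> simp only <;> linarith⟩ (s, x₀) ⟨hs, by
          constructor <;> simp only <;> linarith⟩ (by
          simp only [Prod.dist_eq, dist_self, Real.dist_eq]
          exact max_lt hr (hx2.trans_lt (by linarith)))
        rw [Real.dist_eq] at e2
        have e3 := (abs_lt.1 e2).1
        simp only at e3 ⊢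
        linarith)
    have hanti : AntitoneOn (fun s => potential μ s x₀ - ψ s - 3 * η * s) (Icc 0 1) := by
      have hd : ∀ s ∈ Icc (0 : ℝ) 1, HasDerivWithinAt
          (fun s => potential μ s x₀ - ψ s - 3 * η * s)
          (potentialDs μ s x₀ - (q.eval s - 2 * η) - 3 * η) (Icc 0 1) s := by
        intro s hs
        have := ((hU.1 s hs x₀).hasDerivWithinAt.fun_sub (hψd s).hasDerivWithinAt).fun_sub
          (((hasDerivAt_id s).const_mul (3 * η)).hasDerivWithinAt (s := Icc 0 1))
        simpa [potentialDs] using this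
      refine antitoneOn_of_hasDerivWithinAt_nonpos (convex_Icc 0 1)
        (f' := fun s => potentialDs μ s x₀ - (q.eval s - 2 * η) - 3 * η)
        (fun s hs => (hd s hs).continuousWithinAt)
        (fun s hs => (hd s (interior_subset hs)).mono interior_subset) fun s hs => ?_
      have := (abs_lt.1 (hq s (interior_subset hs))).1
      linarith
    have h := hanti ⟨h0, h12.trans h2⟩ ⟨h0.trans h12, h2⟩ h12
    simp only [hψ1] at h
    have : 3 * η * (s₂ - s₁) ≤ 3 * η * 1 := mul_le_mul_of_nonneg_left (by linarith) (by positivity)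
    linarith
  refine le_of_forall_pos_lt_add fun ε hε => ?_
  have := key (ε / 4) (by positivity)
  linarith

end MonotoneInS

/-! ### Gaussian averages and the heat semigroup -/

section HeatAverage

open ProbabilityTheory

/-- The average `E g(x + √h Z)` for a standard Gaussian `Z`, that is, the heat semigroup of
`½ ∂²_{xx}` at time `h` applied to `g`. -/
noncomputable def heatAverage (h : ℝ) (g : ℝ → ℝ) (x : ℝ) : ℝ :=
  ∫ z, g (x + √h * z) ∂(gaussianReal 0 1)

lemma integrable_pow_gaussianReal (n : ℕ) : Integrable (fun z : ℝ => z ^ n) (gaussianReal 0 1) := by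
  rcases eq_or_ne n 0 with rfl | hn
  · simp
  · have h := (memLp_id_gaussianReal' (μ := 0) (v := 1) (n : ENNReal) (by simp)).integrable_norm_pow hn
    refine h.mono' (by fun_prop) (Eventually.of_forall fun z => ?_)
    simp

lemma integral_sq_gaussianReal : ∫ z : ℝ, z ^ 2 ∂(gaussianReal 0 1) = 1 := by
  have h := variance_eq_sub (memLp_id_gaussianReal (μ := 0) (v := 1) 2)
  rw [variance_id_gaussianReal] at h
  simpa using h.symm

lemma heatAverage_zero (g : ℝ → ℝ) (x : ℝ) : heatAverage 0 g x = g x := by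
  simp [heatAverage]

lemma sq_add_le_two_mul (x y : ℝ) : (x + y) ^ 2 ≤ 2 * x ^ 2 + 2 * y ^ 2 := by
  nlinarith [sq_nonneg (x - y)]

lemma integrable_comp_gaussianReal {g : ℝ → ℝ} (hg : Measurable g) {K : ℝ}
    (hK : ∀ y, |g y| ≤ K * (1 + y ^ 2)) (x c : ℝ) :
    Integrable (fun z => g (x + c * z)) (gaussianReal 0 1) := by
  have hK0 : 0 ≤ K := by simpa using (abs_nonneg _).trans (hK 0)
  refine Integrable.mono' (g := fun z => K * (1 + (2 * x ^ 2 + 2 * c ^ 2 * z ^ 2)))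
    (((integrable_const _).add ((integrable_const _).add
      ((integrable_pow_gaussianReal 2).const_mul _))).const_mul _)
    (hg.comp (by fun_prop)).aestronglyMeasurable (Eventually.of_forall fun z => ?_)
  refine (hK _).trans (mul_le_mul_of_nonneg_left ?_ hK0)
  have := sq_add_le_two_mul x (c * z)
  rw [mul_pow] at this
  linarith

/-- Gaussian averages of certain polynomials of degree four. The fourth moment need only be finite and
is left unevaluated. -/
lemma integral_quartic_gaussianReal (a b c d k : ℝ) :
    ∫ z, (a + b * (k * z) + c * (k * z) ^ 2 - d * (k * z) ^ 4) ∂(gaussianReal 0 1)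
      = a + c * k ^ 2 - d * k ^ 4 * ∫ z, z ^ 4 ∂(gaussianReal 0 1) := by
  have e : ∀ z : ℝ, a + b * (k * z) + c * (k * z) ^ 2 - d * (k * z) ^ 4
      = a + (b * k) * z ^ 1 + (c * k ^ 2) * z ^ 2 - (d * k ^ 4) * z ^ 4 := fun z => by ring
  have i1 := (integrable_pow_gaussianReal 1).const_mul (b * k)
  have i2 := (integrable_pow_gaussianReal 2).const_mul (c * k ^ 2)
  have i4 := (integrable_pow_gaussianReal 4).const_mul (d * k ^ 4)
  have j1 : Integrable (fun z : ℝ => a + b * k * z ^ 1) (gaussianReal 0 1) :=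
    (integrable_const a).add i1
  have j2 : Integrable (fun z : ℝ => a + b * k * z ^ 1 + c * k ^ 2 * z ^ 2) (gaussianReal 0 1) :=
    j1.add i2
  simp_rw [e]
  rw [integral_sub j2 i4, integral_add j1 i2, integral_add (integrable_const a) i1,
    integral_const_mul, integral_const_mul, integral_const_mul, integral_sq_gaussianReal]
  simp [integral_id_gaussianReal]

lemma heatAverage_quadratic {h : ℝ} (hh : 0 ≤ h) (a c x : ℝ) :
    heatAverage h (fun y => a + c * y ^ 2) x = a + c * (x ^ 2 + h) := by
  have e : ∀ z : ℝ, a + c * (x + √h * z) ^ 2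
      = (a + c * x ^ 2) + (2 * c * x) * (√h * z) + c * (√h * z) ^ 2 - 0 * (√h * z) ^ 4 :=
    fun z => by ring
  simp only [heatAverage, e]
  rw [integral_quartic_gaussianReal, Real.sq_sqrt hh]
  ring

lemma heatAverage_mono {f g : ℝ → ℝ} {h x : ℝ}
    (hf : Integrable (fun z => f (x + √h * z)) (gaussianReal 0 1))
    (hg : Integrable (fun z => g (x + √h * z)) (gaussianReal 0 1)) (hfg : ∀ y, f y ≤ g y) :
    heatAverage h f x ≤ heatAverage h g x :=
  integral_mono hf hg fun _ => hfg _

lemma heatAverage_eq_integral_gaussianReal {h : ℝ} (hh : 0 ≤ h) {g : ℝ → ℝ} (hg : Measurable g)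
    (x : ℝ) : heatAverage h g x = ∫ y, g (x + y) ∂(gaussianReal 0 h.toNNReal) := by
  have hmap : gaussianReal 0 h.toNNReal = (gaussianReal 0 1).map (fun z => √h * z) := by
    rw [gaussianReal_map_const_mul, mul_zero, mul_one]
    congr 1
    ext
    simp [Real.sq_sqrt hh, hh]
  have hgx : Measurable fun y => g (x + y) := hg.comp (by fun_prop)
  rw [hmap, integral_map (by fun_prop) hgx.aestronglyMeasurable]
  rfl

/-- The semigroup property. -/
lemma heatAverage_heatAverage {h k : ℝ} (hh : 0 ≤ h) (hk : 0 ≤ k) {g : ℝ → ℝ}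
    (hg : Continuous g) {M : ℝ} (hM : ∀ y, |g y| ≤ M) (x : ℝ) :
    heatAverage k (heatAverage h g) x = heatAverage (h + k) g x := by
  have hgm := hg.measurable
  have hfun : heatAverage h g = fun x => ∫ y, g (x + y) ∂(gaussianReal 0 h.toNNReal) :=
    funext fun x => heatAverage_eq_integral_gaussianReal hh hgm x
  have hm : Continuous (heatAverage h g) := by
    refine continuous_of_dominated (bound := fun _ => M)
      (fun x => (hgm.comp (by fun_prop)).aestronglyMeasurable)
      (fun x => Eventually.of_forall fun z => hM _) (integrable_const _)
      (Eventually.of_forall fun z => by fun_prop)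
  have hsum : (h + k).toNNReal = k.toNNReal + h.toNNReal := by
    rw [add_comm, Real.toNNReal_add hk hh]
  rw [heatAverage_eq_integral_gaussianReal (add_nonneg hh hk) hgm, hsum,
    ← add_zero (0 : ℝ), ← gaussianReal_conv_gaussianReal, integral_conv,
    heatAverage_eq_integral_gaussianReal hk hm.measurable, hfun]
  · simp only [add_assoc]
  · refine Integrable.mono' (integrable_const M) (hgm.comp (by fun_prop)).aestronglyMeasurable
      (Eventually.of_forall fun z => hM _)

/-- A function that dominates its Gaussian averages infinitesimally is a classical supersolution:
a second-order Taylor bound with a quartic error term is averaged term by term. -/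
lemma iteratedDeriv_two_le_of_heatAverage_le {g ψ : ℝ → ℝ} {x t a K : ℝ} (hg : ContDiff ℝ 2 g)
    (hK : ∀ y, |g y| ≤ K * (1 + y ^ 2)) (hψ : HasDerivAt ψ a t) (hψt : ψ t = g x)
    (hle : ∀ h > 0, heatAverage h g x ≤ ψ (t + h)) : 1 / 2 * iteratedDeriv 2 g x ≤ a := by
  have hK0 : 0 ≤ K := by simpa using (abs_nonneg _).trans (hK 0)
  set g1 := deriv g x with hg1
  set g2 := iteratedDeriv 2 g x with hg2
  refine le_of_forall_pos_lt_add fun η hη => ?_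
  have htaylor := taylor_isLittleO (f := g) (n := 2) convex_univ (mem_univ x) hg.contDiffOn
  rw [nhdsWithin_univ] at htaylor
  obtain ⟨δ, hδ, hδt⟩ := Metric.eventually_nhds_iff.1 (htaylor.def (half_pos hη))
  have heval : ∀ y, taylorWithinEval g 2 univ x (x + y) = g x + g1 * y + 1 / 2 * g2 * y ^ 2 := by
    intro y
    rw [taylorWithinEval_succ, taylorWithinEval_succ, taylor_within_zero_eval]
    simp [iteratedDerivWithin_univ, iteratedDeriv_one, ← hg1, ← hg2]
    ring
  set c := 1 / 2 * g2 - η / 2 with hc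
  set A := K * (3 + 2 * x ^ 2) + |g x| + |g1| + |c| with hA
  have hA0 : 0 ≤ A := by positivity
  set d := A * (1 / δ ^ 4 + 1 / δ ^ 2) with hd
  have hd0 : 0 ≤ d := by positivity
  have hlow : ∀ y, g x + g1 * y + c * y ^ 2 - d * y ^ 4 ≤ g (x + y) := by
    intro y
    rcases lt_or_ge |y| δ with hy | hy
    · have h1 := hδt (y := x + y) (by simpa [Real.dist_eq] using hy)
      rw [heval, add_sub_cancel_left, Real.norm_eq_abs, Real.norm_eq_abs,
        abs_of_nonneg (sq_nonneg y)] at h1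
      have h2 := neg_le_of_abs_le h1
      have h3 : 0 ≤ d * y ^ 4 := by positivity
      simp only [hc]
      linarith
    · have h1 : -(K * (1 + (x + y) ^ 2)) ≤ g (x + y) := neg_le_of_abs_le (hK _)
      have h2 : K * (1 + (x + y) ^ 2) ≤ K * (3 + 2 * x ^ 2) * (1 + y ^ 2) := by
        rw [mul_assoc]
        refine mul_le_mul_of_nonneg_left ?_ hK0
        nlinarith [sq_add_le_two_mul x y, mul_nonneg (sq_nonneg x) (sq_nonneg y)]
      have h3 : g x ≤ |g x| * (1 + y ^ 2) := by
        nlinarith [le_abs_self (g x), abs_nonneg (g x), sq_nonneg y]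
      have h4 : g1 * y ≤ |g1| * (1 + y ^ 2) := by
        have f1 : g1 * y ≤ |g1| * |y| := by
          rw [← abs_mul]
          exact le_abs_self _
        have f2 : |y| ≤ 1 + y ^ 2 := by nlinarith [sq_nonneg (|y| - 1), sq_abs y, abs_nonneg y]
        exact f1.trans (mul_le_mul_of_nonneg_left f2 (abs_nonneg _))
      have h5 : c * y ^ 2 ≤ |c| * (1 + y ^ 2) := by
        nlinarith [le_abs_self c, abs_nonneg c, sq_nonneg y]
      have hy2 : δ ^ 2 ≤ y ^ 2 := by
        rw [← sq_abs y]
        exact pow_le_pow_left₀ hδ.le hy 2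
      have h6 : 1 ≤ 1 / δ ^ 2 * y ^ 2 := by
        rw [one_div, inv_mul_eq_div, one_le_div (by positivity)]
        exact hy2
      have h7 : 1 + y ^ 2 ≤ (1 / δ ^ 4 + 1 / δ ^ 2) * y ^ 4 := by
        have e : (1 / δ ^ 4 + 1 / δ ^ 2) * y ^ 4
            = (1 / δ ^ 2 * y ^ 2) ^ 2 + (1 / δ ^ 2 * y ^ 2) * y ^ 2 := by
          field_simp
        rw [e]
        nlinarith [sq_nonneg y]
      have h8 : A * (1 + y ^ 2) ≤ d * y ^ 4 := by
        rw [hd, mul_assoc]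
        exact mul_le_mul_of_nonneg_left h7 hA0
      simp only [hA] at h8
      linarith
  set m := ∫ z, z ^ 4 ∂(gaussianReal 0 1) with hm
  have hbound : ∀ h > 0, c - d * m * h ≤ h⁻¹ • (ψ (t + h) - ψ t) := by
    intro h hh
    have h1 : ∫ z, (g x + g1 * (√h * z) + c * (√h * z) ^ 2 - d * (√h * z) ^ 4) ∂(gaussianReal 0 1)
        ≤ heatAverage h g x := by
      refine integral_mono ?_ (integrable_comp_gaussianReal hg.continuous.measurable hK _ _)
        fun z => hlow _
      have i1 := (integrable_pow_gaussianReal 1).const_mul (g1 * √h)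
      have i2 := (integrable_pow_gaussianReal 2).const_mul (c * √h ^ 2)
      have i4 := (integrable_pow_gaussianReal 4).const_mul (d * √h ^ 4)
      refine ((((integrable_const (g x)).add i1).add i2).sub i4).congr
        (Eventually.of_forall fun z => ?_)
      simp only [Pi.add_apply, Pi.sub_apply]
      ring
    have e4 : √h ^ 4 = h ^ 2 := by
      rw [show (4 : ℕ) = 2 * 2 from rfl, pow_mul, Real.sq_sqrt hh.le]
    rw [integral_quartic_gaussianReal, Real.sq_sqrt hh.le, e4, ← hm] at h1
    have h2 := hle h hh
    rw [smul_eq_mul, inv_mul_eq_div, le_div_iff₀ hh, hψt]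
    nlinarith
  have hlim : Tendsto (fun h => c - d * m * h) (𝓝[>] 0) (𝓝 c) := by
    have : Continuous fun h : ℝ => c - d * m * h := by fun_prop
    simpa using (this.tendsto 0).mono_left nhdsWithin_le_nhds
  have := le_of_tendsto_of_tendsto hlim hψ.tendsto_slope_zero_right
    (eventually_mem_nhdsWithin.mono fun h hh => hbound h hh)
  simp only [hc] at this
  linarith

/-- The averages of a concave function decrease in time. -/
lemma heatAverage_antitone_of_concaveOn {g : ℝ → ℝ} (hg : ConcaveOn ℝ univ g)
    (hgc : Continuous g) {K : ℝ} (hK : ∀ y, |g y| ≤ K * (1 + y ^ 2)) {h k : ℝ} (hh : 0 ≤ h)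
    (hhk : h ≤ k) (x : ℝ) : heatAverage k g x ≤ heatAverage h g x := by
  have hint := fun c => integrable_comp_gaussianReal hgc.measurable hK x c
  have hJensen : heatAverage k g x ≤ g x := by
    have hlin : Integrable (fun z : ℝ => x + √k * z) (gaussianReal 0 1) := by
      simpa using (integrable_const x).add ((integrable_pow_gaussianReal 1).const_mul √k)
    have h1 := hg.le_map_integral hgc.continuousOn isClosed_univ
      (Eventually.of_forall fun z => mem_univ _) hlin (hint √k)
    have h2 : ∫ z : ℝ, (x + √k * z) ∂(gaussianReal 0 1) = x := by
      have i1 : Integrable (fun z : ℝ => √k * z) (gaussianReal 0 1) := by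
        simpa using (integrable_pow_gaussianReal 1).const_mul √k
      rw [integral_add (integrable_const x) i1, integral_const_mul, integral_id_gaussianReal]
      simp
    rw [h2] at h1
    exact h1
  rcases (hh.trans hhk).eq_or_lt with hk | hk
  · obtain rfl : h = k := le_antisymm hhk (hk ▸ hh)
    rfl
  set l := √h / √k with hl
  have hk' : 0 < √k := Real.sqrt_pos.2 hk
  have hl0 : 0 ≤ l := by positivity
  have hl1 : l ≤ 1 := (div_le_one hk').2 (Real.sqrt_le_sqrt hhk)
  have hpt : ∀ z, l * g (x + √k * z) + (1 - l) * g x ≤ g (x + √h * z) := by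
    intro z
    have h1 := hg.2 (mem_univ (x + √k * z)) (mem_univ x) hl0 (sub_nonneg.2 hl1) (by ring)
    have e : l • (x + √k * z) + (1 - l) • x = x + √h * z := by
      simp only [smul_eq_mul, hl]
      field_simp
      ring
    rw [e] at h1
    exact h1
  have h1 : ∫ z, (l * g (x + √k * z) + (1 - l) * g x) ∂(gaussianReal 0 1) ≤ heatAverage h g x :=
    integral_mono (((hint √k).const_mul l).add (integrable_const _)) (hint √h) hpt
  rw [integral_add ((hint √k).const_mul l) (integrable_const _), integral_const_mul] at h1
  simp only [integral_const, probReal_univ, one_smul] at h1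
  have h2 : (1 - l) * heatAverage k g x ≤ (1 - l) * g x :=
    mul_le_mul_of_nonneg_left hJensen (sub_nonneg.2 hl1)
  simp only [heatAverage] at h1 h2 ⊢
  linarith

lemma continuous_heatAverage {f : ℝ → ℝ} (hf : Continuous f) {M : ℝ} (hM : ∀ y, |f y| ≤ M) :
    Continuous fun p : ℝ × ℝ => heatAverage p.1 f p.2 :=
  continuous_of_dominated (bound := fun _ => M)
    (fun p => (hf.comp (by fun_prop)).aestronglyMeasurable)
    (fun p => Eventually.of_forall fun z => hM _) (integrable_const _)
    (Eventually.of_forall fun z => by fun_prop)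

/-- The heat kernel of `½ ∂²_{xx}`. -/
noncomputable def heatKernel (τ c : ℝ) : ℝ := (√(2 * Real.pi * τ))⁻¹ * Real.exp (-c ^ 2 / (2 * τ))

lemma heatKernel_nonneg (τ c : ℝ) : 0 ≤ heatKernel τ c := by
  unfold heatKernel
  positivity

lemma contDiffOn_heatKernel :
    ContDiffOn ℝ 2 (fun p : ℝ × ℝ => heatKernel p.1 p.2) {p | 0 < p.1} := by
  intro p hp
  have hp : 0 < p.1 := hp
  refine ContDiffAt.contDiffWithinAt ?_
  unfold heatKernel
  refine ContDiffAt.mul (ContDiffAt.inv (ContDiffAt.sqrt (by fun_prop) (by positivity))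
    (by positivity)) (ContDiffAt.exp (ContDiffAt.div (by fun_prop) (by fun_prop) (by positivity)))

lemma heatAverage_eq_integral_heatKernel {τ : ℝ} (hτ : 0 < τ) {g : ℝ → ℝ} (hg : Measurable g)
    (x : ℝ) : heatAverage τ g x = ∫ c, heatKernel τ c * g (x + c) := by
  rw [heatAverage_eq_integral_gaussianReal hτ.le hg,
    integral_gaussianReal_eq_integral_smul (by simpa using hτ)]
  simp [gaussianPDFReal, heatKernel, hτ.le]

/-- Gaussian averages of a compactly supported function are smooth for positive times. -/
lemma contDiffOn_heatAverage {f : ℝ → ℝ} (hf : Continuous f) (hfc : HasCompactSupport f) :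
    ContDiffOn ℝ 2 (fun p : ℝ × ℝ => heatAverage p.1 f p.2) {p | 0 < p.1} := by
  obtain ⟨R, hR0, hR⟩ := hfc.isCompact.isBounded.subset_closedBall_lt 0 0
  let χ : ContDiffBump (0 : ℝ) := ⟨R, R + 1, hR0, by linarith⟩
  have hχf : ∀ y, f y * χ y = f y := by
    intro y
    by_cases hy : y ∈ tsupport f
    · rw [χ.one_of_mem_closedBall (hR hy), mul_one]
    · rw [image_eq_zero_of_notMem_tsupport hy, zero_mul]
  have hopen : IsOpen {p : ℝ × ℝ | 0 < p.1} := isOpen_lt continuous_const continuous_fst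
  -- the kernel is cut off outside the support of `f`, which makes it compactly supported
  have key := contDiffOn_convolution_right_with_param_comp (n := 2) (μ := volume)
    (ContinuousLinearMap.mul ℝ ℝ) (s := {p : ℝ × ℝ | 0 < p.1}) (v := fun _ => (0 : ℝ))
    contDiffOn_const (f := f) (g := fun p y => heatKernel p.1 (-y - p.2) * χ (-y))
    (k := Metric.closedBall 0 (R + 1)) hopen (isCompact_closedBall _ _) (by
      intro p y _ hy
      have : χ (-y) = 0 := χ.zero_of_le_dist (by
        simp only [Metric.mem_closedBall, dist_zero_right, not_le] at hy
        simpa using hy.le)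
      simp [this]) hf.locallyIntegrable (by
      refine ContDiffOn.mul ?_ ?_
      · exact contDiffOn_heatKernel.comp (f := fun q : (ℝ × ℝ) × ℝ => (q.1.1, -q.2 - q.1.2))
          (by fun_prop) fun q hq => hq.1
      · exact (χ.contDiff.comp (by fun_prop : ContDiff ℝ 2 fun q : (ℝ × ℝ) × ℝ => -q.2)).contDiffOn)
  refine key.congr fun p hp => ?_
  rw [heatAverage_eq_integral_heatKernel hp hf.measurable, convolution_def]
  symm
  rw [← integral_add_left_eq_self _ p.2]
  refine integral_congr_ae (Eventually.of_forall fun c => ?_)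
  simp only [ContinuousLinearMap.mul_apply', zero_sub, neg_neg, add_sub_cancel_left]
  rw [mul_left_comm, hχf]

end HeatAverage

/-! ### Supersolutions dominate their Gaussian averages -/

section HeatComparison

open ProbabilityTheory

lemma heatAverage_le {f : ℝ → ℝ} (hf : Continuous f) {M : ℝ} (hM : ∀ y, |f y| ≤ M) (h x : ℝ) :
    heatAverage h f x ≤ M := by
  have h1 : heatAverage h f x ≤ ∫ _, M ∂(gaussianReal 0 1) :=
    integral_mono (Integrable.mono' (integrable_const M)
      (hf.comp (by fun_prop)).aestronglyMeasurable (Eventually.of_forall fun z => hM _))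
      (integrable_const _) fun z => (le_abs_self _).trans (hM _)
  simpa using h1

lemma contDiffAt_heatAverage {f : ℝ → ℝ} (hf : Continuous f) (hfc : HasCompactSupport f) {τ : ℝ}
    (hτ : 0 < τ) (x : ℝ) : ContDiffAt ℝ 2 (fun p : ℝ × ℝ => heatAverage p.1 f p.2) (τ, x) :=
  (contDiffOn_heatAverage hf hfc).contDiffAt
    ((isOpen_lt continuous_const continuous_fst).mem_nhds hτ)

lemma contDiff_heatAverage {f : ℝ → ℝ} (hf : Continuous f) (hfc : HasCompactSupport f) {τ : ℝ}
    (hτ : 0 < τ) : ContDiff ℝ 2 (heatAverage τ f) :=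
  contDiff_iff_contDiffAt.2 fun x =>
    (contDiffAt_heatAverage hf hfc hτ x).comp x (f := fun y : ℝ => (τ, y)) (by fun_prop)

lemma hasDerivAt_heatAverage_time {f : ℝ → ℝ} (hf : Continuous f) (hfc : HasCompactSupport f)
    {τ : ℝ} (hτ : 0 < τ) (x : ℝ) :
    HasDerivAt (fun r => heatAverage r f x) (deriv (fun r => heatAverage r f x) τ) τ := by
  have h : ContDiffAt ℝ 2 (fun r => heatAverage r f x) τ :=
    (contDiffAt_heatAverage hf hfc hτ x).comp τ (f := fun y : ℝ => (y, x)) (by fun_prop)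
  exact (h.differentiableAt (by simp)).hasDerivAt

/-- The half of the heat equation for Gaussian averages that the comparison needs; it follows from
the semigroup property. -/
lemma deriv_heatAverage_le {f : ℝ → ℝ} (hf : Continuous f) (hfc : HasCompactSupport f)
    {τ : ℝ} (hτ : 0 < τ) (x : ℝ) :
    deriv (fun r => heatAverage r f x) τ ≤ 1 / 2 * iteratedDeriv 2 (heatAverage τ f) x := by
  obtain ⟨M, hM⟩ := hf.bounded_above_of_compact_support hfc
  have hM' : ∀ y, |f y| ≤ M := hM
  have hM0 : 0 ≤ M := (abs_nonneg _).trans (hM' 0)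
  have hbound : ∀ y, |-heatAverage τ f y| ≤ M * (1 + y ^ 2) := by
    intro y
    have h1 := heatAverage_le hf hM' τ y
    have h2 := heatAverage_le hf.neg (M := M) (fun y => by simpa using hM' y) τ y
    have h3 : heatAverage τ (-f) y = -heatAverage τ f y := integral_neg _
    rw [h3] at h2
    rw [abs_neg]
    have h4 : 0 ≤ M * y ^ 2 := by positivity
    exact abs_le.2 ⟨by linarith, by linarith⟩
  have key := iteratedDeriv_two_le_of_heatAverage_le (contDiff_heatAverage hf hfc hτ).neg hbound
    (hasDerivAt_heatAverage_time hf hfc hτ x).neg rfl (fun h hh => by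
      rw [Pi.neg_apply, ← heatAverage_heatAverage hτ.le hh.le hf hM' x]
      exact (integral_neg _).le)
  have e : iteratedDeriv 2 (fun y => -heatAverage τ f y) x = -iteratedDeriv 2 (heatAverage τ f) x :=
    iteratedDeriv_neg 2 _ x
  change 1 / 2 * iteratedDeriv 2 (fun y => -heatAverage τ f y) x ≤ _ at key
  rw [e] at key
  linarith

/-- A solution of the heat equation with quadratic growth, bounding functions of linear growth. -/
def caloricBound (D t x : ℝ) : ℝ := D * (2 + t + x ^ 2)

lemma mul_le_caloricBound {D t x : ℝ} (hD : 0 ≤ D) : D * (1 + t + |x|) ≤ caloricBound D t x := by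
  refine mul_le_mul_of_nonneg_left ?_ hD
  nlinarith [sq_nonneg (|x| - 1), sq_abs x, abs_nonneg x]

lemma caloricBound_nonneg {D t : ℝ} (hD : 0 ≤ D) (ht : 0 ≤ t) (x : ℝ) : 0 ≤ caloricBound D t x := by
  unfold caloricBound
  positivity

lemma heatAverage_caloricBound (D t x : ℝ) {h : ℝ} (hh : 0 ≤ h) :
    heatAverage h (caloricBound D t) x = caloricBound D (t + h) x := by
  have : caloricBound D t = fun y => D * (2 + t) + D * y ^ 2 := by
    ext y
    unfold caloricBound
    ring
  rw [this, heatAverage_quadratic hh, caloricBound]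
  ring

variable {μ : ℝ → ProbabilityMeasure ℝ}

/-- Comparison of a supersolution with the solution of the heat equation started at time `t₀` from
a continuous compactly supported function. Although the initial inequality is only assumed for one
value `s₀`, semicontinuity extends it to nearby `s` up to a quadratic penalty. -/
lemma IsViscositySupersolution.heatAverage_le_of_hasCompactSupport {w : ℝ × ℝ × ℝ → ℝ}
    (hw : IsViscositySupersolution μ w) {C : ℝ} (hC : 0 < C)
    (hwC : ∀ z ∈ domainZ, -(C * (1 + z.2.1 + |z.2.2|)) ≤ w z)
    {s₀ t₀ : ℝ} (hs₀ : 0 < s₀) (hs₀1 : s₀ ≤ 1) (ht₀ : 0 ≤ t₀) {f : ℝ → ℝ} (hf : Continuous f)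
    (hfc : HasCompactSupport f)
    (hfw : ∀ x, f x ≤ w (s₀, t₀, x) + caloricBound C t₀ x) {h : ℝ} (hh : 0 < h) (x₀ : ℝ) :
    heatAverage h f x₀ ≤ w (s₀, t₀ + h, x₀) + caloricBound C (t₀ + h) x₀ := by
  obtain ⟨M, hM⟩ := hf.bounded_above_of_compact_support hfc
  have hM : ∀ y, |f y| ≤ M := hM
  have hM0 : 0 ≤ M := (abs_nonneg _).trans (hM 0)
  have hwB : ∀ {s t x}, (s, t, x) ∈ domainZ → 0 ≤ w (s, t, x) + caloricBound C t x := by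
    intro s t x hz
    have h1 := hwC _ hz
    have h2 := mul_le_caloricBound (t := t) (x := x) hC.le
    simp only at h1
    linarith
  suffices hmain : ∀ δ > 0, ∀ η > 0, heatAverage h f x₀ - δ - η * (x₀ ^ 2 + 2 * h)
      ≤ w (s₀, t₀ + h, x₀) + caloricBound C (t₀ + h) x₀ by
    refine le_of_forall_pos_le_add fun ε hε => ?_
    have h1 := hmain (ε / 2) (by positivity) (ε / 2 / (x₀ ^ 2 + 2 * h)) (by positivity)
    rw [div_mul_cancel₀ _ (by positivity)] at h1
    linarith
  intro δ hδ η hη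
  by_contra hcon
  push Not at hcon
  -- the initial inequality, up to `δ`, for all `s`
  obtain ⟨n, hn0, hn, hns⟩ : ∃ n : ℝ, 0 ≤ n ∧ M ≤ n * s₀ ^ 2 ∧ ∀ s ∈ Icc (0 : ℝ) 1, ∀ x,
      f x - δ - n * (s - s₀) ^ 2 ≤ w (s, t₀, x) + caloricBound C t₀ x := by
    have htube : ∀ᶠ s in 𝓝 s₀, ∀ x ∈ tsupport f, s ∈ Icc (0 : ℝ) 1 →
        f x - δ ≤ w (s, t₀, x) + caloricBound C t₀ x := by
      refine IsCompact.eventually_forall_of_forall_eventually hfc.isCompact fun x _ => ?_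
      have h1 := hw.lsc (s₀, t₀, x) (mem_domainZ.2 ⟨⟨hs₀.le, hs₀1⟩, ht₀⟩)
        (w (s₀, t₀, x) - δ / 2) (by linarith)
      have h2 : ∀ᶠ p : ℝ × ℝ in 𝓝 (s₀, x), p.1 ∈ Icc (0 : ℝ) 1 →
          w (s₀, t₀, x) - δ / 2 < w (p.1, t₀, p.2) := by
        have := ((by fun_prop : Continuous fun p : ℝ × ℝ => (p.1, t₀, p.2)).tendsto
          (s₀, x)).eventually (eventually_nhdsWithin_iff.1 h1)
        filter_upwards [this] with p hp hp1
        exact hp (mem_domainZ.2 ⟨hp1, ht₀⟩)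
      have h3 : ∀ᶠ p : ℝ × ℝ in 𝓝 (s₀, x), f p.2 - caloricBound C t₀ p.2
          < f x - caloricBound C t₀ x + δ / 2 := by
        have hc : Continuous fun p : ℝ × ℝ => f p.2 - caloricBound C t₀ p.2 := by
          unfold caloricBound
          fun_prop
        exact hc.continuousAt.eventually_lt_const (by simp only; linarith)
      filter_upwards [h2, h3] with p hp2 hp3 hp
      have h4 := hp2 hp
      have h5 := hfw x
      linarith
    obtain ⟨ρ, hρ, hρs⟩ := Metric.eventually_nhds_iff.1 htube
    refine ⟨M / ρ ^ 2 + M / s₀ ^ 2, by positivity, ?_, fun s hs x => ?_⟩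
    · rw [add_mul, div_mul_cancel₀ _ (by positivity)]
      have : 0 ≤ M / ρ ^ 2 * s₀ ^ 2 := by positivity
      linarith
    · have hz : (s, t₀, x) ∈ domainZ := mem_domainZ.2 ⟨hs, ht₀⟩
      have hsq : 0 ≤ (M / ρ ^ 2 + M / s₀ ^ 2) * (s - s₀) ^ 2 := by positivity
      rcases lt_or_ge |s - s₀| ρ with hsρ | hsρ
      · by_cases hx : x ∈ tsupport f
        · have := hρs (by rwa [Real.dist_eq]) x hx hs
          linarith
        · rw [image_eq_zero_of_notMem_tsupport hx]
          have := hwB hz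
          linarith
      · have h1 : M ≤ M / ρ ^ 2 * (s - s₀) ^ 2 := by
          rw [div_mul_eq_mul_div, le_div_iff₀ (by positivity), ← sq_abs (s - s₀)]
          exact mul_le_mul_of_nonneg_left (pow_le_pow_left₀ hρ.le hsρ 2) hM0
        have h2 : 0 ≤ M / s₀ ^ 2 * (s - s₀) ^ 2 := by positivity
        have h3 := (le_abs_self _).trans (hM x)
        have h4 := hwB hz
        rw [add_mul]
        linarith
  -- the barrier; the last term makes it a strict subsolution and the minimum below exist
  set Φ : ℝ × ℝ × ℝ → ℝ := fun z => heatAverage (z.2.1 - t₀) f z.2.2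
    + (-δ - n * (z.1 - s₀) ^ 2 - C * (2 + z.2.1 + z.2.2 ^ 2)
      - η * (z.2.2 ^ 2 + 2 * (z.2.1 - t₀))) with hΦ
  have hΦc : Continuous Φ :=
    ((continuous_heatAverage hf hM).comp (f := fun z : ℝ × ℝ × ℝ => (z.2.1 - t₀, z.2.2))
      (by fun_prop)).add (by fun_prop)
  obtain ⟨R, hR1, hRM, hRh, hRx⟩ : ∃ R : ℝ, 1 ≤ R ∧ M ≤ η * R ∧ h < R ∧ |x₀| < R := by
    refine ⟨1 + M / η + h + |x₀|, ?_, ?_, ?_, ?_⟩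
    · have : 0 ≤ M / η := by positivity
      have := abs_nonneg x₀
      linarith
    · have e : η * (1 + M / η + h + |x₀|) = M + η * (1 + h + |x₀|) := by
        field_simp
        ring
      rw [e]
      have : 0 ≤ η * (1 + h + |x₀|) := by positivity
      linarith
    · have : 0 ≤ M / η := by positivity
      have := abs_nonneg x₀
      linarith
    · have : 0 ≤ M / η := by positivity
      linarith
  set K : Set (ℝ × ℝ × ℝ) := Icc 0 1 ×ˢ Icc t₀ (t₀ + R) ×ˢ Icc (-R) R with hK
  have hKc : IsCompact K := isCompact_Icc.prod (isCompact_Icc.prod isCompact_Icc)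
  have hKZ : K ⊆ domainZ := by
    rintro ⟨s, t, x⟩ ⟨hs, ht, -⟩
    exact mem_domainZ.2 ⟨hs, ht₀.trans ht.1⟩
  have hz2 : (s₀, t₀ + h, x₀) ∈ K := by
    refine ⟨⟨hs₀.le, hs₀1⟩, ⟨by simp only; linarith, by simp only; linarith⟩, ?_⟩
    have := abs_lt.1 hRx
    exact ⟨this.1.le, this.2.le⟩
  obtain ⟨⟨s, t, x⟩, hzK, hzmin⟩ := LowerSemicontinuousOn.exists_isMinOn (f := fun z => w z - Φ z)
    ⟨_, hz2⟩ hKc (by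
      simp only [sub_eq_add_neg]
      exact (hw.lsc.mono hKZ).add hΦc.neg.continuousOn.lowerSemicontinuousOn)
  have hzmin := isMinOn_iff.1 hzmin
  have hneg : w (s, t, x) - Φ (s, t, x) < 0 := by
    refine (hzmin _ hz2).trans_lt ?_
    simp only [hΦ, sub_self, add_sub_cancel_left]
    simp only [caloricBound] at hcon
    linarith
  simp only [hΦ] at hneg
  have hzZ := hKZ hzK
  have hB := hwB hzZ
  simp only [caloricBound] at hB
  have hu := heatAverage_le hf hM (t - t₀) x
  obtain ⟨⟨hs0, hs1⟩, ⟨htt, htR⟩, ⟨hxl, hxr⟩⟩ := hzK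
  simp only at hs0 hs1 htt htR hxl hxr
  have hn' : 0 ≤ n * (s - s₀) ^ 2 := by positivity
  have hη1 : 0 ≤ η * x ^ 2 := by positivity
  have hη2 : 0 ≤ η * (2 * (t - t₀)) := mul_nonneg hη.le (by linarith)
  -- the minimum is attained neither at `s = 0`, by the size of `n`, nor at `t = t₀`, by the initial
  -- inequality, nor at the remaining faces, by the size of `R`
  have hspos : 0 < s := by
    rcases hs0.eq_or_lt with h0 | h0
    · exfalso
      rw [← h0, zero_sub, neg_sq] at hneg
      rw [← h0] at hB
      linarith
    · exact h0
  have htpos : t₀ < t := by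
    rcases htt.eq_or_lt with h0 | h0
    · exfalso
      have h1 := hns s ⟨hs0, hs1⟩ x
      subst h0
      rw [sub_self, heatAverage_zero] at hneg
      simp only [caloricBound] at h1
      linarith
    · exact h0
  have htR' : t < t₀ + R := by
    refine htR.lt_of_ne fun h0 => ?_
    have h1 : η * (2 * (t - t₀)) = η * R + η * R := by
      rw [h0]
      ring
    linarith
  have hxR : |x| < R := by
    by_contra h0
    have h1 : R ≤ |x| := not_lt.1 h0
    have h2 : η * R ≤ η * x ^ 2 := by
      refine mul_le_mul_of_nonneg_left ?_ hη.le
      rw [← sq_abs]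
      nlinarith
    linarith
  have hτ : 0 < t - t₀ := sub_pos.2 htpos
  have hΦC : ContDiffAt ℝ 2 Φ (s, t, x) :=
    ((contDiffAt_heatAverage hf hfc hτ x).comp (s, t, x)
      (f := fun z : ℝ × ℝ × ℝ => (z.2.1 - t₀, z.2.2)) (by fun_prop)).add (by fun_prop)
  have hpde := hw.pdeOperator_nonneg_of_local hC hwC (z₀ := (s, t, x))
    (mem_parabolicInterior.2 ⟨⟨hspos, hs1⟩, ht₀.trans_lt htpos⟩) hΦC (by
      have hU : univ ×ˢ Ioo t₀ (t₀ + R) ×ˢ Ioo (-R) R ∈ 𝓝 (s, t, x) :=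
        prod_mem_nhds univ_mem (prod_mem_nhds (Ioo_mem_nhds htpos htR')
          (Ioo_mem_nhds (abs_lt.1 hxR).1 (abs_lt.1 hxR).2))
      filter_upwards [hU]
      rintro ⟨s', t', x'⟩ ⟨-, h2, h3⟩ hZ
      exact hzmin _ ⟨(mem_domainZ.1 hZ).1, ⟨h2.1.le, h2.2.le⟩, ⟨h3.1.le, h3.2.le⟩⟩)
  have hdt : HasDerivAt (fun r => Φ (s, r, x))
      (deriv (fun r => heatAverage r f x) (t - t₀) + (-C - 2 * η)) t := by
    have h1 := (hasDerivAt_heatAverage_time hf hfc hτ x).comp_sub_const t t₀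
    have h2 : HasDerivAt (fun r => -δ - n * (s - s₀) ^ 2 - C * (2 + r + x ^ 2)
        - η * (x ^ 2 + 2 * (r - t₀))) (-C - 2 * η) t := by
      have e : (fun r => -δ - n * (s - s₀) ^ 2 - C * (2 + r + x ^ 2) - η * (x ^ 2 + 2 * (r - t₀)))
          = fun r => (-C - 2 * η) * r + (-δ - n * (s - s₀) ^ 2 - C * (2 + x ^ 2)
            - η * (x ^ 2 - 2 * t₀)) := by
        ext r
        ring
      rw [e]
      simpa using ((hasDerivAt_id t).const_mul (-C - 2 * η)).add_const
        (-δ - n * (s - s₀) ^ 2 - C * (2 + x ^ 2) - η * (x ^ 2 - 2 * t₀))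
    exact h1.add h2
  have hds : HasDerivAt (fun r => Φ (r, t, x)) (deriv (fun r => Φ (r, t, x)) s) s := by
    have h1 : ContDiffAt ℝ 2 (fun r => Φ (r, t, x)) s :=
      hΦC.comp s (f := fun r : ℝ => (r, t, x)) (by fun_prop)
    exact (h1.differentiableAt (by simp)).hasDerivAt
  have hdx : iteratedDeriv 2 (fun y => Φ (s, t, y)) x
      = iteratedDeriv 2 (heatAverage (t - t₀) f) x + -(2 * (C + η)) := by
    simp only [hΦ]
    rw [iteratedDeriv_fun_add (contDiff_heatAverage hf hfc hτ).contDiffAt (by fun_prop)]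
    congr 1
    have e : (fun y => -δ - n * (s - s₀) ^ 2 - C * (2 + t + y ^ 2) - η * (y ^ 2 + 2 * (t - t₀)))
        = fun y => -(C + η) * y ^ 2 + (-δ - n * (s - s₀) ^ 2 - C * (2 + t)
          - η * (2 * (t - t₀))) := by
      ext y
      ring
    rw [e]
    refine iteratedDeriv_two_eq (g' := fun y => -(C + η) * (2 * y)) (fun y => ?_) ?_
    · simpa using ((hasDerivAt_pow 2 y).const_mul (-(C + η))).add_const
        (-δ - n * (s - s₀) ^ 2 - C * (2 + t) - η * (2 * (t - t₀)))
    · have := ((hasDerivAt_id x).const_mul (2 : ℝ)).const_mul (-(C + η))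
      refine this.congr_deriv ?_
      ring
  rw [pdeOperator_eq hzZ hdt hds, hdx] at hpde
  have h1 := (le_min_iff.1 hpde).1
  have h2 := deriv_heatAverage_le hf hfc hτ x
  linarith

/-- A non-negative lower semicontinuous function is a pointwise limit from below of continuous
compactly supported functions: Lipschitz regularisations multiplied by cutoffs. -/
lemma LowerSemicontinuous.exists_seq_hasCompactSupport_tendsto {V : ℝ → ℝ}
    (hV : LowerSemicontinuous V) (hV0 : ∀ x, 0 ≤ V x) :
    ∃ f : ℕ → ℝ → ℝ, (∀ n, Continuous (f n)) ∧ (∀ n, HasCompactSupport (f n)) ∧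
      (∀ n x, 0 ≤ f n x) ∧ (∀ n x, f n x ≤ V x) ∧
      ∀ x, Tendsto (fun n => f n x) atTop (𝓝 (V x)) := by
  set g : ℕ → ℝ → ℝ := fun n x => ⨅ y, (V y + n * |x - y|) with hg
  have hpos : ∀ (n : ℕ) x y, 0 ≤ V y + n * |x - y| := fun n x y =>
    add_nonneg (hV0 y) (by positivity)
  have hbdd : ∀ (n : ℕ) x, BddBelow (range fun y => V y + n * |x - y|) := fun n x =>
    ⟨0, by rintro _ ⟨y, rfl⟩; exact hpos n x y⟩
  have hg0 : ∀ n x, 0 ≤ g n x := fun n x => le_ciInf fun y => hpos n x y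
  have hgV : ∀ n x, g n x ≤ V x := fun n x => by simpa using ciInf_le (hbdd n x) x
  have hglip : ∀ (n : ℕ) x x', g n x ≤ g n x' + n * |x - x'| := by
    intro n x x'
    rw [← sub_le_iff_le_add]
    refine le_ciInf fun y => ?_
    have h1 : g n x ≤ V y + n * |x - y| := ciInf_le (hbdd n x) y
    have h2 : (n : ℝ) * |x - y| ≤ n * (|x - x'| + |x' - y|) :=
      mul_le_mul_of_nonneg_left (abs_sub_le x x' y) (Nat.cast_nonneg n)
    linarith
  have hgc : ∀ n, Continuous (g n) := by
    intro n
    refine (LipschitzWith.of_dist_le_mul (K := n) fun x y => ?_).continuous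
    rw [Real.dist_eq, Real.dist_eq, NNReal.coe_natCast, abs_sub_le_iff]
    have h1 := hglip n x y
    have h2 := hglip n y x
    rw [abs_sub_comm y x] at h2
    constructor <;> linarith
  have hgt : ∀ x, Tendsto (fun n => g n x) atTop (𝓝 (V x)) := by
    intro x
    refine tendsto_order.2 ⟨fun a ha => ?_, fun a ha =>
      Eventually.of_forall fun n => (hgV n x).trans_lt ha⟩
    obtain ⟨b, hab, hbV⟩ := exists_between ha
    obtain ⟨r, hr, hrV⟩ := Metric.eventually_nhds_iff.1 (hV x b hbV)
    obtain ⟨N, hN⟩ := exists_nat_gt (V x / r)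
    filter_upwards [eventually_ge_atTop N] with n hn
    refine hab.trans_le (le_ciInf fun y => ?_)
    rcases lt_or_ge |x - y| r with hxy | hxy
    · have h1 : b < V y := hrV (by rwa [Real.dist_eq, abs_sub_comm])
      have h2 : 0 ≤ (n : ℝ) * |x - y| := by positivity
      linarith
    · have h1 : V x ≤ n * r := by
        rw [← div_le_iff₀ hr]
        exact hN.le.trans (Nat.cast_le.2 hn)
      have h2 : (n : ℝ) * r ≤ n * |x - y| := mul_le_mul_of_nonneg_left hxy (Nat.cast_nonneg n)
      have h3 := hV0 y
      linarith
  set χ : ℕ → ℝ → ℝ := fun n x => max 0 (min 1 (n - |x|)) with hχ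
  have hχ0 : ∀ n x, 0 ≤ χ n x := fun n x => le_max_left _ _
  have hχ1 : ∀ n x, χ n x ≤ 1 := fun n x => max_le zero_le_one (min_le_left _ _)
  refine ⟨fun n x => g n x * χ n x, fun n => (hgc n).mul (by simp only [hχ]; fun_prop),
    fun n => ?_, fun n x => mul_nonneg (hg0 n x) (hχ0 n x),
    fun n x => (mul_le_of_le_one_right (hg0 n x) (hχ1 n x)).trans (hgV n x), fun x => ?_⟩
  · refine HasCompactSupport.intro (isCompact_closedBall (0 : ℝ) n) fun x hx => ?_
    have hx' : (n : ℝ) < |x| := by simpa using hx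
    have : χ n x = 0 := max_eq_left ((min_le_right _ _).trans (by linarith))
    simp only [this, mul_zero]
  · refine (hgt x).congr' ?_
    obtain ⟨N, hN⟩ := exists_nat_gt (1 + |x|)
    filter_upwards [eventually_ge_atTop N] with n hn
    have h1 : (N : ℝ) ≤ n := Nat.cast_le.2 hn
    have : χ n x = 1 := by
      simp only [hχ]
      rw [min_eq_left (by linarith), max_eq_right zero_le_one]
    rw [this, mul_one]

lemma IsViscositySupersolution.lowerSemicontinuous_slice {w : ℝ × ℝ × ℝ → ℝ}
    (hw : IsViscositySupersolution μ w) {s t : ℝ} (hs : 0 ≤ s) (hs1 : s ≤ 1) (ht : 0 ≤ t) :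
    LowerSemicontinuous fun x => w (s, t, x) := by
  intro x a ha
  have h1 := hw.lsc (s, t, x) (mem_domainZ.2 ⟨⟨hs, hs1⟩, ht⟩) a ha
  have h2 := ((by fun_prop : Continuous fun y : ℝ => (s, t, y)).tendsto x).eventually
    (eventually_nhdsWithin_iff.1 h1)
  exact h2.mono fun y hy => hy (mem_domainZ.2 ⟨⟨hs, hs1⟩, ht⟩)

lemma caloricBound_le {D t : ℝ} (hD : 0 ≤ D) (ht : 0 ≤ t) (y : ℝ) :
    caloricBound D t y ≤ D * (2 + t) * (1 + y ^ 2) := by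
  unfold caloricBound
  rw [mul_assoc]
  refine mul_le_mul_of_nonneg_left ?_ hD
  nlinarith [sq_nonneg y, mul_nonneg ht (sq_nonneg y)]

lemma IsViscositySupersolution.abs_min_caloricBound_le {w : ℝ × ℝ × ℝ → ℝ} {C : ℝ} (hC : 0 < C)
    (hwC : ∀ z ∈ domainZ, -(C * (1 + z.2.1 + |z.2.2|)) ≤ w z) {s t : ℝ} (hs : 0 ≤ s) (hs1 : s ≤ 1)
    (ht : 0 ≤ t) (x : ℝ) :
    |min (w (s, t, x)) (caloricBound C t x)| ≤ caloricBound C t x := by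
  have h1 := hwC (s, t, x) (mem_domainZ.2 ⟨⟨hs, hs1⟩, ht⟩)
  have h2 := mul_le_caloricBound (t := t) (x := x) hC.le
  have h3 := caloricBound_nonneg hC.le ht x
  simp only at h1
  exact abs_le.2 ⟨le_min (by linarith) (by linarith), min_le_right _ _⟩

/-- A supersolution, truncated from above, dominates its Gaussian averages. -/
lemma IsViscositySupersolution.heatAverage_min_le {w : ℝ × ℝ × ℝ → ℝ}
    (hw : IsViscositySupersolution μ w) {C : ℝ} (hC : 0 < C)
    (hwC : ∀ z ∈ domainZ, -(C * (1 + z.2.1 + |z.2.2|)) ≤ w z)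
    {s₀ t₀ : ℝ} (hs₀ : 0 < s₀) (hs₀1 : s₀ ≤ 1) (ht₀ : 0 ≤ t₀) {h : ℝ} (hh : 0 < h) (x₀ : ℝ) :
    heatAverage h (fun x => min (w (s₀, t₀, x)) (caloricBound C t₀ x)) x₀
      ≤ min (w (s₀, t₀ + h, x₀)) (caloricBound C (t₀ + h) x₀) := by
  set W : ℝ → ℝ := fun x => min (w (s₀, t₀, x)) (caloricBound C t₀ x) with hW
  have hBc : Continuous (caloricBound C t₀) := by
    unfold caloricBound
    fun_prop
  have hWlsc : LowerSemicontinuous W :=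
    (hw.lowerSemicontinuous_slice hs₀.le hs₀1 ht₀).inf hBc.lowerSemicontinuous
  have hWabs : ∀ x, |W x| ≤ caloricBound C t₀ x := fun x =>
    IsViscositySupersolution.abs_min_caloricBound_le hC hwC hs₀.le hs₀1 ht₀ x
  have hWK : ∀ y, |W y| ≤ C * (2 + t₀) * (1 + y ^ 2) := fun y =>
    (hWabs y).trans (caloricBound_le hC.le ht₀ y)
  have hWint := integrable_comp_gaussianReal hWlsc.measurable hWK x₀ √h
  have hBint := integrable_comp_gaussianReal hBc.measurable (K := C * (2 + t₀)) (fun y => by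
    rw [abs_of_nonneg (caloricBound_nonneg hC.le ht₀ y)]
    exact caloricBound_le hC.le ht₀ y) x₀ √h
  obtain ⟨f, hfc, hfs, hf0, hfV, hft⟩ := (hWlsc.add
    hBc.lowerSemicontinuous).exists_seq_hasCompactSupport_tendsto (fun x => by
      have := neg_le_of_abs_le (hWabs x)
      linarith)
  have hlim : Tendsto (fun n => heatAverage h (f n) x₀) atTop
      (𝓝 (heatAverage h (fun x => W x + caloricBound C t₀ x) x₀)) := by
    refine tendsto_integral_of_dominated_convergence
      (fun z => W (x₀ + √h * z) + caloricBound C t₀ (x₀ + √h * z))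
      (fun n => ((hfc n).comp (by fun_prop)).aestronglyMeasurable) (hWint.add hBint)
      (fun n => Eventually.of_forall fun z => ?_) (Eventually.of_forall fun z => hft _)
    rw [Real.norm_eq_abs, abs_of_nonneg (hf0 _ _)]
    exact hfV _ _
  have hle := le_of_tendsto' hlim fun n =>
    hw.heatAverage_le_of_hasCompactSupport hC hwC hs₀ hs₀1 ht₀ (hfc n) (hfs n)
      (fun x => (hfV n x).trans (add_le_add_left (min_le_left _ _) _)) hh x₀
  have hsplit : heatAverage h (fun x => W x + caloricBound C t₀ x) x₀
      = heatAverage h W x₀ + heatAverage h (caloricBound C t₀) x₀ := integral_add hWint hBint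
  rw [hsplit, heatAverage_caloricBound _ _ _ hh.le] at hle
  refine le_min (by linarith) ?_
  rw [← heatAverage_caloricBound _ _ _ hh.le]
  exact heatAverage_mono hWint hBint fun y => min_le_right _ _

end HeatComparison

/-! ### Extension of a supersolution to the past -/

section Extension

open ProbabilityTheory

/-- The nearest point of `[0,1]`. -/
def unitClamp (s : ℝ) : ℝ := max 0 (min s 1)

lemma unitClamp_mem (s : ℝ) : unitClamp s ∈ Icc (0 : ℝ) 1 :=
  ⟨le_max_left _ _, max_le zero_le_one (min_le_right _ _)⟩

lemma unitClamp_of_nonpos {s : ℝ} (hs : s ≤ 0) : unitClamp s = 0 :=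
  max_eq_left ((min_le_left _ _).trans hs)

lemma unitClamp_of_mem {s : ℝ} (hs : s ∈ Icc (0 : ℝ) 1) : unitClamp s = s := by
  rw [unitClamp, min_eq_left hs.2, max_eq_right hs.1]

lemma unitClamp_pos {s : ℝ} (hs : 0 < s) : 0 < unitClamp s :=
  lt_max_of_lt_right (lt_min hs zero_lt_one)

lemma unitClamp_mono : Monotone unitClamp := fun _ _ h =>
  max_le_max le_rfl (min_le_min h le_rfl)

lemma unitClamp_sub_le {s s' : ℝ} (h : s ≤ s') : unitClamp s' - unitClamp s ≤ s' - s := by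
  unfold unitClamp
  rcases max_cases 0 (min s' 1) with h1 | h1 <;> rcases max_cases 0 (min s 1) with h2 | h2 <;>
    rcases min_cases s' 1 with h3 | h3 <;> rcases min_cases s 1 with h4 | h4 <;> linarith

lemma continuous_unitClamp : Continuous unitClamp := by
  unfold unitClamp
  fun_prop

variable {μ : ℝ → ProbabilityMeasure ℝ} {w : ℝ × ℝ × ℝ → ℝ} {C : ℝ}

/-- A supersolution truncated from above by `caloricBound`, continued by the boundary datum
`U(0,·)` to `s ≤ 0` and to `t ≤ 0`, and constantly in `s` beyond `s = 1`. -/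
noncomputable def pastExtension (μ : ℝ → ProbabilityMeasure ℝ) (w : ℝ × ℝ × ℝ → ℝ) (C : ℝ)
    (s t x : ℝ) : ℝ :=
  if 0 < s ∧ 0 < t then min (w (unitClamp s, t, x)) (caloricBound C t x) else potential μ 0 x

lemma pastExtension_of_nonpos_left {s : ℝ} (hs : s ≤ 0) (t x : ℝ) :
    pastExtension μ w C s t x = potential μ 0 x := if_neg fun h => h.1.not_ge hs

lemma pastExtension_of_nonpos_right (s : ℝ) {t : ℝ} (ht : t ≤ 0) (x : ℝ) :
    pastExtension μ w C s t x = potential μ 0 x := if_neg fun h => h.2.not_ge ht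

lemma pastExtension_of_pos {s t : ℝ} (hs : 0 < s) (ht : 0 < t) (x : ℝ) :
    pastExtension μ w C s t x = min (w (unitClamp s, t, x)) (caloricBound C t x) :=
  if_pos ⟨hs, ht⟩

lemma pastExtension_le {s t : ℝ} (hs : 0 < s) (hs1 : s ≤ 1) (ht : 0 < t) (x : ℝ) :
    pastExtension μ w C s t x ≤ w (s, t, x) := by
  rw [pastExtension_of_pos hs ht, unitClamp_of_mem ⟨hs.le, hs1⟩]
  exact min_le_left _ _

lemma measurable_pastExtension (hμ : IsMarginalFamily μ) (hw : IsViscositySupersolution μ w) :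
    Measurable fun z : ℝ × ℝ × ℝ => pastExtension μ w C z.1 z.2.1 z.2.2 := by
  have hproj : Continuous fun z : ℝ × ℝ × ℝ => (unitClamp z.1, max 0 z.2.1, z.2.2) :=
    (continuous_unitClamp.comp continuous_fst).prodMk (by fun_prop)
  have hlsc : LowerSemicontinuous fun z : ℝ × ℝ × ℝ => w (unitClamp z.1, max 0 z.2.1, z.2.2) := by
    intro z a ha
    have hZ : ∀ z : ℝ × ℝ × ℝ, (unitClamp z.1, max 0 z.2.1, z.2.2) ∈ domainZ := fun z =>
      mem_domainZ.2 ⟨unitClamp_mem _, le_max_left _ _⟩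
    exact ((hproj.tendsto z).eventually (eventually_nhdsWithin_iff.1 (hw.lsc _ (hZ z) a ha))).mono
      fun y hy => hy (hZ y)
  have e : (fun z : ℝ × ℝ × ℝ => pastExtension μ w C z.1 z.2.1 z.2.2) = fun z =>
      if 0 < z.1 ∧ 0 < z.2.1 then
        min (w (unitClamp z.1, max 0 z.2.1, z.2.2)) (caloricBound C z.2.1 z.2.2)
      else potential μ 0 z.2.2 := by
    ext z
    unfold pastExtension
    split_ifs with h
    · rw [max_eq_right h.2.le]
    · rfl
  rw [e]
  refine Measurable.ite ?_ (hlsc.measurable.min ?_) ?_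
  · exact ((isOpen_lt continuous_const continuous_fst).inter
      (isOpen_lt continuous_const (by fun_prop : Continuous fun z : ℝ × ℝ × ℝ => z.2.1))).measurableSet
  · unfold caloricBound
    fun_prop
  · exact (hμ.continuous_potential ⟨le_rfl, zero_le_one⟩).measurable.comp (by fun_prop)

lemma le_pastExtension (hC : 0 < C) (hwC : ∀ z ∈ domainZ, -(C * (1 + z.2.1 + |z.2.2|)) ≤ w z)
    (hUC : ∀ x, -(C * (1 + |x|)) ≤ potential μ 0 x) (s t x : ℝ) :
    -(C * (1 + |t| + |x|)) ≤ pastExtension μ w C s t x := by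
  unfold pastExtension
  split_ifs with h
  · have h1 := hwC (unitClamp s, t, x) (mem_domainZ.2 ⟨unitClamp_mem s, h.2.le⟩)
    have h2 := caloricBound_nonneg hC.le h.2.le x
    have h3 : 0 ≤ C * (1 + t + |x|) := mul_nonneg hC.le (by linarith [abs_nonneg x])
    rw [abs_of_pos h.2]
    exact le_min h1 (by linarith)
  · have h1 := hUC x
    have h2 : C * (1 + |x|) ≤ C * (1 + |t| + |x|) :=
      mul_le_mul_of_nonneg_left (by linarith [abs_nonneg t]) hC.le
    linarith

lemma abs_pastExtension_le (hC : 0 < C)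
    (hwC : ∀ z ∈ domainZ, -(C * (1 + z.2.1 + |z.2.2|)) ≤ w z)
    (hUC : ∀ x, -(C * (1 + |x|)) ≤ potential μ 0 x) (s t x : ℝ) :
    |pastExtension μ w C s t x| ≤ C * (2 + |t|) * (1 + x ^ 2) := by
  have h0 : caloricBound C |t| x ≤ C * (2 + |t|) * (1 + x ^ 2) :=
    caloricBound_le hC.le (abs_nonneg t) x
  have h1 := le_pastExtension (s := s) (t := t) (x := x) hC hwC hUC
  have h2 := mul_le_caloricBound (t := |t|) (x := x) hC.le
  refine abs_le.2 ⟨by linarith, ?_⟩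
  refine le_trans ?_ h0
  unfold pastExtension
  split_ifs with h
  · rw [abs_of_pos h.2]
    exact min_le_right _ _
  · exact (potential_nonpos _ _).trans (caloricBound_nonneg hC.le (abs_nonneg t) x)

lemma pastExtension_sub_potential_mono (hμ : IsMarginalFamily μ) (hU : PotentialRegular μ)
    (hw : IsViscositySupersolution μ w) (hC : 0 < C)
    (hwC : ∀ z ∈ domainZ, -(C * (1 + z.2.1 + |z.2.2|)) ≤ w z) {s s' : ℝ} (hss' : s ≤ s')
    (t x : ℝ) :
    pastExtension μ w C s t x - potential μ (unitClamp s) x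
      ≤ pastExtension μ w C s' t x - potential μ (unitClamp s') x := by
  have hUanti : potential μ (unitClamp s') x ≤ potential μ (unitClamp s) x :=
    hμ.antitoneOn_potential x (unitClamp_mem s) (unitClamp_mem s') (unitClamp_mono hss')
  rcases le_or_gt t 0 with ht | ht
  · rw [pastExtension_of_nonpos_right _ ht, pastExtension_of_nonpos_right _ ht]
    linarith
  rcases le_or_gt s' 0 with hs' | hs'
  · rw [pastExtension_of_nonpos_left hs', pastExtension_of_nonpos_left (hss'.trans hs')]
    linarith
  have hB := caloricBound_nonneg hC.le ht.le x
  have hmono := fun s₁ (h : 0 ≤ s₁) (h12 : s₁ ≤ unitClamp s') =>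
    hw.sub_potential_mono hU hC hwC x h h12 (unitClamp_mem s').2 ht
  rw [pastExtension_of_pos hs' ht, ← min_sub_sub_right]
  rcases le_or_gt s 0 with hs | hs
  · rw [pastExtension_of_nonpos_left hs, unitClamp_of_nonpos hs, sub_self]
    have h1 := hmono 0 le_rfl (unitClamp_mem s').1
    have hz : ((0 : ℝ), t, x) ∈ domainZ := mem_domainZ.2 ⟨⟨le_rfl, zero_le_one⟩, ht.le⟩
    have h2 := hw.boundary _ ((mem_parabolicBoundary hz).2 (Or.inl rfl))
    have h3 := potential_nonpos (μ := μ) (unitClamp s') x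
    simp only at h2
    exact le_min (by linarith) (by linarith)
  · rw [pastExtension_of_pos hs ht, ← min_sub_sub_right]
    exact min_le_min (hmono _ (unitClamp_mem s).1 (unitClamp_mono hss')) (by linarith)

lemma abs_potential_zero_le (hC : 0 < C) (hUC : ∀ x, -(C * (1 + |x|)) ≤ potential μ 0 x) (y : ℝ) :
    |potential μ 0 y| ≤ C * 2 * (1 + y ^ 2) := by
  rw [abs_of_nonpos (potential_nonpos _ _)]
  have h1 := hUC y
  have h2 : C * (1 + |y|) ≤ C * (2 * (1 + y ^ 2)) :=
    mul_le_mul_of_nonneg_left (by nlinarith [sq_nonneg (|y| - 1), sq_abs y, abs_nonneg y]) hC.le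
  linarith

lemma heatAverage_pastExtension_le (hμ : IsMarginalFamily μ)
    (hw : IsViscositySupersolution μ w) (hC : 0 < C)
    (hwC : ∀ z ∈ domainZ, -(C * (1 + z.2.1 + |z.2.2|)) ≤ w z)
    (hUC : ∀ x, -(C * (1 + |x|)) ≤ potential μ 0 x) {h : ℝ} (hh : 0 < h) (s t x : ℝ) :
    heatAverage h (pastExtension μ w C s t) x ≤ pastExtension μ w C s (t + h) x := by
  have h01 : (0 : ℝ) ∈ Icc (0 : ℝ) 1 := ⟨le_rfl, zero_le_one⟩
  have hUc := hμ.continuous_potential h01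
  have hUK := abs_potential_zero_le hC hUC
  have hanti := fun {h k : ℝ} (hh : 0 ≤ h) (hhk : h ≤ k) =>
    heatAverage_antitone_of_concaveOn (hμ.concaveOn_potential h01) hUc hUK hh hhk x
  have hJensen : heatAverage h (potential μ 0) x ≤ potential μ 0 x := by
    simpa [heatAverage_zero] using hanti le_rfl hh.le
  rcases le_or_gt s 0 with hs | hs
  · rw [pastExtension_of_nonpos_left hs,
      funext fun y => pastExtension_of_nonpos_left (μ := μ) (w := w) (C := C) hs t y]
    exact hJensen
  have hc := unitClamp_mem s
  rcases le_or_gt t 0 with ht | ht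
  · rw [funext fun y => pastExtension_of_nonpos_right (μ := μ) (w := w) (C := C) s ht y]
    rcases le_or_gt (t + h) 0 with hth | hth
    · rw [pastExtension_of_nonpos_right _ hth]
      exact hJensen
    rw [pastExtension_of_pos hs hth]
    -- shorten the averaging time to `t + h`, so that it starts at the boundary `t = 0`
    refine (hanti hth.le (by linarith : t + h ≤ h)).trans ?_
    have key := hw.heatAverage_min_le hC hwC (unitClamp_pos hs) hc.2 le_rfl hth x
    rw [zero_add] at key
    refine le_trans (heatAverage_mono (integrable_comp_gaussianReal hUc.measurable hUK _ _)
      (integrable_comp_gaussianReal (((hw.lowerSemicontinuous_slice hc.1 hc.2 le_rfl).measurable).min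
        (by unfold caloricBound; fun_prop)) (fun y =>
          (IsViscositySupersolution.abs_min_caloricBound_le hC hwC hc.1 hc.2 le_rfl y).trans
            (caloricBound_le hC.le le_rfl y)) _ _) fun y => ?_) key
    have hz : (unitClamp s, (0 : ℝ), y) ∈ domainZ := mem_domainZ.2 ⟨hc, le_rfl⟩
    exact le_min (hw.boundary _ ((mem_parabolicBoundary hz).2 (Or.inr rfl)))
      ((potential_nonpos _ _).trans (caloricBound_nonneg hC.le le_rfl y))
  · rw [pastExtension_of_pos hs (by linarith : 0 < t + h),
      funext fun y => pastExtension_of_pos (μ := μ) (w := w) (C := C) hs ht y]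
    exact hw.heatAverage_min_le hC hwC (unitClamp_pos hs) hc.2 ht.le hh x

end Extension

/-! ### Mollification in the past -/

section Mollification

open ProbabilityTheory

/-- A smooth sub-probability density `ρ` supported in `(0, ε) × (0, ε) × [-ε, ε]`. Convolution with
`ρ` at `(s, t, x)` only sees points `(s', t', x')` with `s' < s` and `t' < t`. -/
structure IsPastMollifier (ρ : ℝ × ℝ × ℝ → ℝ) (ε : ℝ) : Prop where
  contDiff : ContDiff ℝ 2 ρ
  nonneg : ∀ ζ, 0 ≤ ρ ζ
  support : ∀ ζ, ρ ζ ≠ 0 → ζ.1 ∈ Ioo 0 ε ∧ ζ.2.1 ∈ Ioo 0 ε ∧ |ζ.2.2| ≤ ε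
  integral_le_one : ∫ ζ, ρ ζ ≤ 1

/-- The convolution of `ρ` with `W`. -/
noncomputable def mollify (ρ W : ℝ × ℝ × ℝ → ℝ) (z : ℝ × ℝ × ℝ) : ℝ := ∫ ζ, ρ ζ * W (z - ζ)

variable {ρ W : ℝ × ℝ × ℝ → ℝ} {ε : ℝ}

lemma IsPastMollifier.hasCompactSupport (hρ : IsPastMollifier ρ ε) : HasCompactSupport ρ := by
  refine HasCompactSupport.of_support_subset_isCompact
    (K := Icc 0 ε ×ˢ Icc 0 ε ×ˢ Icc (-ε) ε)
    (isCompact_Icc.prod (isCompact_Icc.prod isCompact_Icc)) fun ζ hζ => ?_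
  obtain ⟨h1, h2, h3⟩ := hρ.support ζ hζ
  exact ⟨Ioo_subset_Icc_self h1, Ioo_subset_Icc_self h2, abs_le.1 h3⟩

lemma IsPastMollifier.integrable (hρ : IsPastMollifier ρ ε) : Integrable ρ :=
  hρ.contDiff.continuous.integrable_of_hasCompactSupport hρ.hasCompactSupport

lemma locallyIntegrable_of_abs_le (hW : Measurable W) {K : ℝ}
    (hWK : ∀ z, |W z| ≤ K * (2 + |z.2.1|) * (1 + z.2.2 ^ 2)) : LocallyIntegrable W := by
  have hc : Continuous fun z : ℝ × ℝ × ℝ => K * (2 + |z.2.1|) * (1 + z.2.2 ^ 2) := by fun_prop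
  refine hc.locallyIntegrable.mono hW.aestronglyMeasurable (Eventually.of_forall fun z => ?_)
  exact (hWK z).trans (le_abs_self _)

instance isAddHaarMeasure_volume_triple : (volume : Measure (ℝ × ℝ × ℝ)).IsAddHaarMeasure :=
  Measure.prod.instIsAddHaarMeasure _ _

lemma IsPastMollifier.integrable_mul (hρ : IsPastMollifier ρ ε) (hW : LocallyIntegrable W)
    (z : ℝ × ℝ × ℝ) : Integrable fun ζ => ρ ζ * W (z - ζ) :=
  hρ.hasCompactSupport.convolutionExists_left (ContinuousLinearMap.mul ℝ ℝ)
    hρ.contDiff.continuous hW z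

lemma IsPastMollifier.contDiff_mollify (hρ : IsPastMollifier ρ ε) (hW : LocallyIntegrable W) :
    ContDiff ℝ 2 (mollify ρ W) :=
  hρ.hasCompactSupport.contDiff_convolution_left (n := 2) (ContinuousLinearMap.mul ℝ ℝ)
    hρ.contDiff hW

/-- The mass of `ρ` may be less than one, which is why the constant `m` has to be non-positive. -/
lemma IsPastMollifier.le_integral_mul (hρ : IsPastMollifier ρ ε) {V : ℝ × ℝ × ℝ → ℝ}
    (hV : Integrable fun ζ => ρ ζ * V ζ) {m : ℝ} (hm : m ≤ 0) (h : ∀ ζ, ρ ζ ≠ 0 → m ≤ V ζ) :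
    m ≤ ∫ ζ, ρ ζ * V ζ := by
  have h1 : ∫ ζ, ρ ζ * m ≤ ∫ ζ, ρ ζ * V ζ := by
    refine integral_mono (hρ.integrable.mul_const m) hV fun ζ => ?_
    by_cases h0 : ρ ζ = 0
    · simp [h0]
    · exact mul_le_mul_of_nonneg_left (h ζ h0) (hρ.nonneg ζ)
  rw [integral_mul_const] at h1
  nlinarith [hρ.integral_le_one]

lemma IsPastMollifier.le_mollify (hρ : IsPastMollifier ρ ε) (hW : LocallyIntegrable W)
    {z : ℝ × ℝ × ℝ} {m : ℝ} (hm : m ≤ 0) (h : ∀ ζ, ρ ζ ≠ 0 → m ≤ W (z - ζ)) :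
    m ≤ mollify ρ W z :=
  hρ.le_integral_mul (hρ.integrable_mul hW z) hm h

lemma IsPastMollifier.abs_mollify_le (hρ : IsPastMollifier ρ ε) (hW : LocallyIntegrable W)
    {z : ℝ × ℝ × ℝ} {m : ℝ} (hm : 0 ≤ m) (h : ∀ ζ, ρ ζ ≠ 0 → |W (z - ζ)| ≤ m) :
    |mollify ρ W z| ≤ m := by
  have h1 := hρ.le_mollify hW (neg_nonpos.2 hm) fun ζ hζ => neg_le_of_abs_le (h ζ hζ)
  have h2 := hρ.le_mollify hW.neg (neg_nonpos.2 hm) fun ζ hζ =>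
    neg_le_neg (le_of_abs_le (h ζ hζ))
  have h3 : mollify ρ (-W) z = -mollify ρ W z := by
    simp only [mollify, Pi.neg_apply, mul_neg, integral_neg]
  rw [h3] at h2
  exact abs_le.2 ⟨h1, by linarith⟩

/-- Mollification commutes with Gaussian averages in `x`, hence preserves the inequality between a
function and its averages. -/
lemma IsPastMollifier.heatAverage_mollify_le (hρ : IsPastMollifier ρ ε) (hW : Measurable W) {K : ℝ}
    (hK : 0 ≤ K) (hWK : ∀ z, |W z| ≤ K * (2 + |z.2.1|) * (1 + z.2.2 ^ 2)) {h : ℝ}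
    (hheat : ∀ s t x, heatAverage h (fun y => W (s, t, y)) x ≤ W (s, t + h, x)) (s t x : ℝ) :
    heatAverage h (fun y => mollify ρ W (s, t, y)) x ≤ mollify ρ W (s, t + h, x) := by
  have hWl := locallyIntegrable_of_abs_le hW hWK
  set F : ℝ → ℝ × ℝ × ℝ → ℝ := fun y ζ => ρ ζ * W ((s, t, x + √h * y) - ζ) with hF
  have hFint : Integrable (Function.uncurry F) ((gaussianReal 0 1).prod volume) := by
    have hg : Integrable (fun y : ℝ => K * (2 + |t| + ε) * (1 + 2 * (|x| + ε) ^ 2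
        + 2 * √h ^ 2 * y ^ 2)) (gaussianReal 0 1) :=
      ((integrable_const _).add ((integrable_pow_gaussianReal 2).const_mul _)).const_mul _
    refine (hg.mul_prod hρ.integrable).mono' ?_ (Eventually.of_forall fun p => ?_)
    · refine Measurable.aestronglyMeasurable ?_
      exact (hρ.contDiff.continuous.measurable.comp measurable_snd).mul (hW.comp (by fun_prop))
    · obtain ⟨y, ζ⟩ := p
      simp only [Function.uncurry, hF, norm_mul, Real.norm_eq_abs]
      rw [abs_of_nonneg (hρ.nonneg ζ), mul_comm]
      by_cases h0 : ρ ζ = 0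
      · simp [h0]
      refine mul_le_mul_of_nonneg_right ?_ (hρ.nonneg ζ)
      obtain ⟨-, h2, h3⟩ := hρ.support ζ h0
      refine (hWK _).trans ?_
      have e1 : |t - ζ.2.1| ≤ |t| + ε := by
        refine (abs_sub _ _).trans ?_
        rw [abs_of_pos h2.1]
        linarith [h2.2]
      have e2 : (x + √h * y - ζ.2.2) ^ 2 ≤ 2 * (|x| + ε) ^ 2 + 2 * √h ^ 2 * y ^ 2 := by
        have f1 := sq_add_le_two_mul (x - ζ.2.2) (√h * y)
        have f2 : (x - ζ.2.2) ^ 2 ≤ (|x| + ε) ^ 2 := by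
          rw [← sq_abs (x - ζ.2.2)]
          exact pow_le_pow_left₀ (abs_nonneg _) ((abs_sub _ _).trans (by linarith)) 2
        have e : x + √h * y - ζ.2.2 = x - ζ.2.2 + √h * y := by ring
        rw [e]
        rw [mul_pow] at f1
        linarith
      have hε : 0 ≤ ε := (h2.1.trans h2.2).le
      refine mul_le_mul ?_ ?_ (by positivity) (by positivity)
      · exact mul_le_mul_of_nonneg_left (by simp only [Prod.snd_sub, Prod.fst_sub]; linarith) hK
      · simp only [Prod.snd_sub]
        linarith
  have hswap : heatAverage h (fun y => mollify ρ W (s, t, y)) x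
      = ∫ ζ, ρ ζ * heatAverage h (fun y => W (s - ζ.1, t - ζ.2.1, y)) (x - ζ.2.2) := by
    refine (integral_integral_swap hFint).trans (integral_congr_ae (Eventually.of_forall fun ζ => ?_))
    simp only [hF, integral_const_mul, heatAverage]
    congr 2
    ext y
    congr 1
    ext
    · rfl
    · rfl
    · simp only [Prod.snd_sub]
      ring
  have hint : Integrable fun ζ : ℝ × ℝ × ℝ =>
      ρ ζ * heatAverage h (fun y => W (s - ζ.1, t - ζ.2.1, y)) (x - ζ.2.2) := by
    refine hFint.integral_prod_right.congr (Eventually.of_forall fun ζ => ?_)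
    simp only [hF, Function.uncurry, integral_const_mul, heatAverage]
    congr 2
    ext y
    congr 1
    ext
    · rfl
    · rfl
    · simp only [Prod.snd_sub]
      ring
  rw [hswap]
  refine integral_mono hint (hρ.integrable_mul hWl _) fun ζ => ?_
  refine mul_le_mul_of_nonneg_left ?_ (hρ.nonneg ζ)
  have := hheat (s - ζ.1) (t - ζ.2.1) (x - ζ.2.2)
  have e : (s, t + h, x) - ζ = (s - ζ.1, t - ζ.2.1 + h, x - ζ.2.2) := by
    ext
    · rfl
    · simp only [Prod.snd_sub, Prod.fst_sub]
      ring
    · rfl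
  rw [e]
  exact this

lemma hasDerivAt_time_of_contDiff {φ : ℝ × ℝ × ℝ → ℝ} (hφ : ContDiff ℝ 2 φ) (s t x : ℝ) :
    HasDerivAt (fun r => φ (s, r, x)) (deriv (fun r => φ (s, r, x)) t) t :=
  ((hφ.comp (by fun_prop : ContDiff ℝ 2 fun r : ℝ => (s, r, x))).differentiable
    (by simp)).differentiableAt.hasDerivAt

lemma hasDerivAt_fst_of_contDiff {φ : ℝ × ℝ × ℝ → ℝ} (hφ : ContDiff ℝ 2 φ) (s t x : ℝ) :
    HasDerivAt (fun r => φ (r, t, x)) (deriv (fun r => φ (r, t, x)) s) s :=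
  ((hφ.comp (by fun_prop : ContDiff ℝ 2 fun r : ℝ => (r, t, x))).differentiable
    (by simp)).differentiableAt.hasDerivAt

/-- The mollification of a function dominating its Gaussian averages is a classical supersolution
of the heat equation. -/
lemma IsPastMollifier.iteratedDeriv_mollify_le (hρ : IsPastMollifier ρ ε) (hW : Measurable W)
    {K : ℝ} (hK : 0 ≤ K) (hε : 0 ≤ ε) (hWK : ∀ z, |W z| ≤ K * (2 + |z.2.1|) * (1 + z.2.2 ^ 2))
    (hheat : ∀ h > 0, ∀ s t x, heatAverage h (fun y => W (s, t, y)) x ≤ W (s, t + h, x))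
    (s t x : ℝ) :
    1 / 2 * iteratedDeriv 2 (fun y => mollify ρ W (s, t, y)) x
      ≤ deriv (fun r => mollify ρ W (s, r, x)) t := by
  have hWl := locallyIntegrable_of_abs_le hW hWK
  have hC := hρ.contDiff_mollify hWl
  refine iteratedDeriv_two_le_of_heatAverage_le (K := K * (2 + |t| + ε) * (2 + 2 * ε ^ 2))
    (hC.comp (by fun_prop)) (fun y => ?_) (hasDerivAt_time_of_contDiff hC s t x) rfl
    fun h hh => hρ.heatAverage_mollify_le hW hK hWK (hheat h hh) s t x
  refine hρ.abs_mollify_le hWl (by positivity) fun ζ hζ => ?_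
  obtain ⟨-, h2, h3⟩ := hρ.support ζ hζ
  refine (hWK _).trans ?_
  rw [mul_assoc (K * (2 + |t| + ε))]
  simp only [Prod.snd_sub, Prod.fst_sub]
  refine mul_le_mul (mul_le_mul_of_nonneg_left ?_ hK) ?_ (by positivity) (by positivity)
  · have : |t - ζ.2.1| ≤ |t| + ε := by
      refine (abs_sub _ _).trans ?_
      rw [abs_of_pos h2.1]
      linarith [h2.2]
    linarith
  · have f1 := sq_add_le_two_mul y (-ζ.2.2)
    rw [← sub_eq_add_neg, neg_sq] at f1
    have f2 : ζ.2.2 ^ 2 ≤ ε ^ 2 := by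
      rw [← sq_abs]
      exact pow_le_pow_left₀ (abs_nonneg _) h3 2
    nlinarith [mul_nonneg (sq_nonneg ε) (sq_nonneg y)]

/-- If `W - U` is non-decreasing in `s`, then the mollification of `W` has an `s`-derivative bounded
below by nearby values of `∂_s U`. -/
lemma IsPastMollifier.le_deriv_mollify {μ : ℝ → ProbabilityMeasure ℝ} (hU : PotentialRegular μ)
    (hρ : IsPastMollifier ρ ε) (hε : 0 < ε) (hWl : LocallyIntegrable W)
    (hmono : ∀ s s', s ≤ s' → ∀ t x, W (s, t, x) - potential μ (unitClamp s) x
      ≤ W (s', t, x) - potential μ (unitClamp s') x)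
    {s x κ : ℝ} (hs : s ∈ Icc (0 : ℝ) 1) (hκ : κ ≤ 0)
    (hd : ∀ r ∈ Icc (0 : ℝ) 1, ∀ y, |r - s| ≤ ε → |y - x| ≤ ε → κ ≤ potentialDs μ r y) (t : ℝ) :
    κ ≤ deriv (fun r => mollify ρ W (r, t, x)) s := by
  have hlim := (hasDerivAt_fst_of_contDiff (hρ.contDiff_mollify hWl) s t x).tendsto_slope_zero_right
  refine ge_of_tendsto hlim ?_
  filter_upwards [Ioo_mem_nhdsGT hε] with h hh
  rw [smul_eq_mul, inv_mul_eq_div, le_div_iff₀ hh.1]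
  have hi1 := hρ.integrable_mul hWl (s + h, t, x)
  have hi2 := hρ.integrable_mul hWl (s, t, x)
  have e : mollify ρ W (s + h, t, x) - mollify ρ W (s, t, x)
      = ∫ ζ, ρ ζ * (W ((s + h, t, x) - ζ) - W ((s, t, x) - ζ)) := by
    simp only [mollify]
    rw [← integral_sub hi1 hi2]
    simp only [mul_sub]
  rw [e]
  refine hρ.le_integral_mul ((hi1.sub hi2).congr (Eventually.of_forall fun ζ => ?_))
    (mul_nonpos_of_nonpos_of_nonneg hκ hh.1.le) fun ζ hζ => ?_
  · simp only [Pi.sub_apply]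
    ring
  obtain ⟨h1, h2, h3⟩ := hρ.support ζ hζ
  set y := x - ζ.2.2 with hy
  set r₁ := unitClamp (s - ζ.1) with hr₁
  set r₂ := unitClamp (s + h - ζ.1) with hr₂
  have hr12 : r₁ ≤ r₂ := unitClamp_mono (by linarith [hh.1])
  have hr21 : r₂ - r₁ ≤ h := (unitClamp_sub_le (by linarith [hh.1])).trans (by linarith)
  have hs' : unitClamp s = s := unitClamp_of_mem hs
  have hr₁s : s - ε ≤ r₁ := by
    have := unitClamp_sub_le (s := s - ζ.1) (s' := s) (by linarith [h1.1])
    rw [hs'] at this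
    linarith [h1.2]
  have hr₂s : r₂ ≤ s + ε := by
    rcases le_total (s + h - ζ.1) s with h0 | h0
    · have := unitClamp_mono h0
      rw [hs'] at this
      linarith
    · have := unitClamp_sub_le h0
      rw [hs'] at this
      linarith [h1.1, hh.2]
  have hsub : Icc r₁ r₂ ⊆ Icc (0 : ℝ) 1 := Icc_subset_Icc (unitClamp_mem _).1 (unitClamp_mem _).2
  have hder : ∀ r ∈ Icc (0 : ℝ) 1, HasDerivWithinAt (fun r => potential μ r y - κ * r)
      (potentialDs μ r y - κ) (Icc 0 1) r := by
    intro r hr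
    simpa [potentialDs] using (hU.1 r hr y).hasDerivWithinAt.fun_sub
      (((hasDerivAt_id r).const_mul κ).hasDerivWithinAt (s := Icc 0 1))
  have hmonoU : MonotoneOn (fun r => potential μ r y - κ * r) (Icc r₁ r₂) := by
    refine monotoneOn_of_hasDerivWithinAt_nonneg (convex_Icc r₁ r₂)
      (f' := fun r => potentialDs μ r y - κ)
      (fun r hr => ((hder r (hsub hr)).mono hsub).continuousWithinAt)
      (fun r hr => (hder r (hsub (interior_subset hr))).mono (interior_subset.trans hsub))
      fun r hr => ?_
    have hr' := interior_subset hr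
    refine sub_nonneg.2 (hd r (hsub hr') y ?_ ?_)
    · exact abs_le.2 ⟨by linarith [hr'.1], by linarith [hr'.2]⟩
    · rw [hy, sub_sub_cancel_left, abs_neg]
      exact h3
  have hU12 := hmonoU (left_mem_Icc.2 hr12) (right_mem_Icc.2 hr12) hr12
  have hW12 := hmono (s - ζ.1) (s + h - ζ.1) (by linarith [hh.1]) (t - ζ.2.1) y
  -- clamping shortens the increment, which is harmless since `κ ≤ 0`
  have hκh : κ * h ≤ κ * (r₂ - r₁) := mul_le_mul_of_nonpos_left hr21 hκ
  change κ * h ≤ W (s + h - ζ.1, t - ζ.2.1, y) - W (s - ζ.1, t - ζ.2.1, y)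
  simp only at hU12
  linarith

end Mollification

/-! ### Truncated heat kernels as mollifiers -/

section HeatMollifier

open ProbabilityTheory

/-- The product of bumps `k` in `s` and in `t` with the heat kernel in `x`, cut off by `χ`. The bump
`k` is meant to be centred at a positive time, away from the singularity of the heat kernel. -/
noncomputable def heatMollifier {c₀ : ℝ} (k : ContDiffBump c₀) (χ : ContDiffBump (0 : ℝ))
    (ζ : ℝ × ℝ × ℝ) : ℝ :=
  k.normed volume ζ.1 * (k.normed volume ζ.2.1 * (heatKernel ζ.2.1 ζ.2.2 * χ ζ.2.2))

variable {c₀ : ℝ} {k : ContDiffBump c₀} {χ : ContDiffBump (0 : ℝ)}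

lemma mem_Ioo_of_normed_ne_zero (hk : k.rOut < c₀) {a : ℝ}
    (ha : k.normed volume a ≠ 0) : a ∈ Ioo 0 (2 * c₀) := by
  have h1 : a ∈ Metric.ball c₀ k.rOut := by
    rw [← k.support_normed_eq (μ := volume)]
    exact ha
  rw [Real.ball_eq_Ioo] at h1
  exact ⟨by linarith [h1.1], by linarith [h1.2]⟩

lemma heatMollifier_nonneg (ζ : ℝ × ℝ × ℝ) : 0 ≤ heatMollifier k χ ζ :=
  mul_nonneg (k.nonneg_normed _)
    (mul_nonneg (k.nonneg_normed _) (mul_nonneg (heatKernel_nonneg _ _) χ.nonneg))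

lemma contDiff_heatMollifier (hk : k.rOut < c₀) : ContDiff ℝ 2 (heatMollifier k χ) := by
  have hkC : ContDiff ℝ 2 (k.normed volume) := k.contDiff_normed
  refine (hkC.comp contDiff_fst).mul (contDiff_iff_contDiffAt.2 fun ζ => ?_)
  rcases lt_or_ge 0 ζ.2.1 with h | h
  · refine (hkC.contDiffAt.comp ζ (by fun_prop)).mul (ContDiffAt.mul ?_
      (χ.contDiff.contDiffAt.comp ζ (by fun_prop)))
    exact (contDiffOn_heatKernel.contDiffAt
      ((isOpen_lt continuous_const continuous_fst).mem_nhds h)).comp ζ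
      (f := fun ζ : ℝ × ℝ × ℝ => (ζ.2.1, ζ.2.2)) (by fun_prop)
  · have h0 : ζ.2.1 < c₀ - k.rOut := by linarith
    have hev : ∀ᶠ ξ : ℝ × ℝ × ℝ in 𝓝 ζ, ξ.2.1 < c₀ - k.rOut :=
      (isOpen_lt (by fun_prop) continuous_const).mem_nhds h0
    refine (contDiffAt_const (c := (0 : ℝ))).congr_of_eventuallyEq (hev.mono fun ξ hξ => ?_)
    have : k.normed volume ξ.2.1 = 0 := by
      by_contra hne
      have h1 : ξ.2.1 ∈ Metric.ball c₀ k.rOut := by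
        rw [← k.support_normed_eq (μ := volume)]
        exact hne
      rw [Real.ball_eq_Ioo] at h1
      linarith [h1.1]
    simp only [this, zero_mul]

lemma heatMollifier_support (hk : k.rOut < c₀) {ζ : ℝ × ℝ × ℝ} (hζ : heatMollifier k χ ζ ≠ 0) :
    ζ.1 ∈ Ioo 0 (2 * c₀) ∧ ζ.2.1 ∈ Ioo 0 (2 * c₀) ∧ |ζ.2.2| ≤ χ.rOut := by
  have h1 := right_ne_zero_of_mul hζ
  refine ⟨mem_Ioo_of_normed_ne_zero hk (left_ne_zero_of_mul hζ),
    mem_Ioo_of_normed_ne_zero hk (left_ne_zero_of_mul h1), ?_⟩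
  by_contra h
  refine right_ne_zero_of_mul (right_ne_zero_of_mul h1) (χ.zero_of_le_dist ?_)
  rw [dist_zero_right, Real.norm_eq_abs]
  exact (not_le.1 h).le

/-- Integration against the mollifier, by integrating out `x` first. -/
lemma integral_heatMollifier_mul_le (hk : k.rOut < c₀) {V : ℝ × ℝ × ℝ → ℝ}
    (hV : Integrable fun ζ => heatMollifier k χ ζ * V ζ) {m : ℝ}
    (h : ∀ a ∈ Ioo 0 (2 * c₀), ∀ b ∈ Ioo 0 (2 * c₀),
      ∫ c, heatKernel b c * (χ c * V (a, b, c)) ≤ m) :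
    ∫ ζ, heatMollifier k χ ζ * V ζ ≤ m := by
  set F : ℝ × ℝ × ℝ → ℝ := fun ζ => heatMollifier k χ ζ * V ζ with hF
  have hinner : ∀ a b, ∫ c, F (a, b, c) ≤ k.normed volume a * (k.normed volume b * m) := by
    intro a b
    have e : ∀ c, F (a, b, c) = k.normed volume a * (k.normed volume b *
        (heatKernel b c * (χ c * V (a, b, c)))) := by
      intro c
      simp only [hF, heatMollifier]
      ring
    simp only [e, integral_const_mul]
    by_cases ha : k.normed volume a = 0
    · simp [ha]
    by_cases hb : k.normed volume b = 0
    · simp [hb]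
    exact mul_le_mul_of_nonneg_left (mul_le_mul_of_nonneg_left
      (h a (mem_Ioo_of_normed_ne_zero hk ha) b (mem_Ioo_of_normed_ne_zero hk hb))
      (k.nonneg_normed _)) (k.nonneg_normed _)
  have hkint : Integrable (k.normed volume) := k.integrable_normed
  have hmiddle : ∀ᵐ a, ∫ p, F (a, p) ≤ k.normed volume a * m := by
    filter_upwards [hV.prod_right_ae] with a ha
    have h1 : ∫ p, F (a, p) = ∫ b, ∫ c, F (a, b, c) := integral_prod _ ha
    rw [h1]
    have h2 : ∫ b, ∫ c, F (a, b, c) ≤ ∫ b, k.normed volume a * (k.normed volume b * m) :=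
      integral_mono ha.integral_prod_left ((hkint.mul_const m).const_mul _) (hinner a)
    rwa [integral_const_mul, integral_mul_const, k.integral_normed, one_mul] at h2
  have h1 : ∫ ζ, F ζ = ∫ a, ∫ p, F (a, p) := integral_prod _ hV
  rw [h1]
  have h2 : ∫ a, ∫ p, F (a, p) ≤ ∫ a, k.normed volume a * m :=
    integral_mono_ae hV.integral_prod_left (hkint.mul_const m) hmiddle
  rwa [integral_mul_const, k.integral_normed, one_mul] at h2

lemma integral_heatKernel_mul_sub {τ : ℝ} (hτ : 0 < τ) {g : ℝ → ℝ} (hg : Measurable g) (x : ℝ) :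
    ∫ c, heatKernel τ c * g (x - c) = heatAverage τ g x := by
  rw [heatAverage_eq_integral_heatKernel hτ hg, ← integral_neg_eq_self]
  simp [heatKernel]

lemma isPastMollifier_heatMollifier (hk : k.rOut < c₀) (hχ : 2 * c₀ ≤ χ.rOut) :
    IsPastMollifier (heatMollifier k χ) χ.rOut := by
  have hsupp : ∀ ζ, heatMollifier k χ ζ ≠ 0 →
      ζ.1 ∈ Ioo 0 χ.rOut ∧ ζ.2.1 ∈ Ioo 0 χ.rOut ∧ |ζ.2.2| ≤ χ.rOut := fun ζ hζ => by
    obtain ⟨h1, h2, h3⟩ := heatMollifier_support hk hζ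
    exact ⟨⟨h1.1, h1.2.trans_le hχ⟩, ⟨h2.1, h2.2.trans_le hχ⟩, h3⟩
  have hint : Integrable (heatMollifier k χ) := by
    refine (contDiff_heatMollifier hk).continuous.integrable_of_hasCompactSupport
      (HasCompactSupport.of_support_subset_isCompact
        (K := Icc 0 χ.rOut ×ˢ Icc 0 χ.rOut ×ˢ Icc (-χ.rOut) χ.rOut)
        (isCompact_Icc.prod (isCompact_Icc.prod isCompact_Icc)) fun ζ hζ => ?_)
    obtain ⟨h1, h2, h3⟩ := hsupp ζ hζ
    exact ⟨Ioo_subset_Icc_self h1, Ioo_subset_Icc_self h2, abs_le.1 h3⟩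
  refine ⟨contDiff_heatMollifier hk, heatMollifier_nonneg, hsupp, ?_⟩
  have h := integral_heatMollifier_mul_le (k := k) (χ := χ) hk (V := fun _ => 1) (m := 1)
    (by simpa using hint) fun a _ b hb => by
      have e := integral_heatKernel_mul_sub hb.1 (g := fun y => χ (-y))
        (χ.continuous.measurable.comp measurable_neg) 0
      simp only [zero_sub, neg_neg] at e
      simp only [mul_one, e]
      refine heatAverage_le (χ.continuous.comp continuous_neg) (fun y => ?_) b 0
      rw [Function.comp_apply, abs_of_nonneg χ.nonneg]
      exact χ.le_one
  simpa using h

/-- The error made by cutting off the heat kernel at time `b` is of order `b`. -/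
lemma heatAverage_cutoff_le {g : ℝ → ℝ} (hg : Measurable g) {K A x : ℝ}
    (hgK : ∀ y, |g y| ≤ K * (1 + y ^ 2)) (hA : 0 ≤ A) (hgA : ∀ y, -(A * (1 + |y - x|)) ≤ g y)
    {b : ℝ} (hb0 : 0 ≤ b) (hb1 : b ≤ 1) :
    heatAverage b (fun y => χ (x - y) * g y) x ≤ heatAverage b g x
      + 2 * A / χ.rIn ^ 2 * (1 + ∫ z, z ^ 4 ∂(gaussianReal 0 1)) * b := by
  set A' := 2 * A / χ.rIn ^ 2 with hA'
  have hr := χ.rIn_pos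
  have hA'0 : 0 ≤ A' := by positivity
  have hK0 : 0 ≤ K := by simpa using (abs_nonneg _).trans (hgK 0)
  set m := ∫ z, z ^ 4 ∂(gaussianReal 0 1) with hm
  have hm0 : 0 ≤ m := integral_nonneg fun z => by positivity
  have hpt : ∀ y, χ (x - y) * g y ≤ g y + (A' * (y - x) ^ 2 + A' * (y - x) ^ 4) := by
    intro y
    have hq : 0 ≤ A' * (y - x) ^ 2 + A' * (y - x) ^ 4 := by positivity
    rcases le_or_gt |y - x| χ.rIn with h | h
    · have : χ (x - y) = 1 := χ.one_of_mem_closedBall (by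
        rwa [Metric.mem_closedBall, dist_zero_right, Real.norm_eq_abs, abs_sub_comm])
      rw [this]
      linarith
    · have h1 : (1 - χ (x - y)) * -(A * (1 + |y - x|)) ≤ (1 - χ (x - y)) * g y :=
        mul_le_mul_of_nonneg_left (hgA y) (sub_nonneg.2 χ.le_one)
      have h2 : 0 ≤ χ (x - y) * (A * (1 + |y - x|)) := by
        have := χ.nonneg (x := x - y)
        positivity
      have h3 : A * (1 + |y - x|) ≤ A * (2 * (1 + (y - x) ^ 2)) := by
        refine mul_le_mul_of_nonneg_left ?_ hA
        nlinarith [sq_nonneg (|y - x| - 1), sq_abs (y - x), abs_nonneg (y - x)]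
      have h4 : χ.rIn ^ 2 ≤ (y - x) ^ 2 := by
        rw [← sq_abs (y - x)]
        exact pow_le_pow_left₀ hr.le h.le 2
      have h5 : 1 ≤ (y - x) ^ 2 / χ.rIn ^ 2 := (one_le_div (by positivity)).2 h4
      have h6 : A * (2 * (1 + (y - x) ^ 2)) * 1
          ≤ A * (2 * (1 + (y - x) ^ 2)) * ((y - x) ^ 2 / χ.rIn ^ 2) :=
        mul_le_mul_of_nonneg_left h5 (by positivity)
      have h7 : A * (2 * (1 + (y - x) ^ 2)) * ((y - x) ^ 2 / χ.rIn ^ 2)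
          = A' * (y - x) ^ 2 + A' * (y - x) ^ 4 := by
        simp only [hA']
        ring
      linarith
  have hgint := integrable_comp_gaussianReal hg hgK x √b
  have hχm : Measurable fun y => χ (x - y) * g y :=
    (χ.continuous.measurable.comp (by fun_prop)).mul hg
  have hχint := integrable_comp_gaussianReal hχm (K := K) (fun y => by
    rw [abs_mul, abs_of_nonneg χ.nonneg]
    exact (mul_le_of_le_one_left (abs_nonneg _) χ.le_one).trans (hgK y)) x √b
  have hqint : Integrable (fun z : ℝ => A' * (√b * z) ^ 2 + A' * (√b * z) ^ 4)
      (gaussianReal 0 1) := by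
    refine (((integrable_pow_gaussianReal 2).const_mul (A' * √b ^ 2)).add
      ((integrable_pow_gaussianReal 4).const_mul (A' * √b ^ 4))).congr
      (Eventually.of_forall fun z => ?_)
    simp only [Pi.add_apply]
    ring
  have h1 : heatAverage b (fun y => χ (x - y) * g y) x
      ≤ ∫ z, (g (x + √b * z) + (A' * (√b * z) ^ 2 + A' * (√b * z) ^ 4)) ∂(gaussianReal 0 1) := by
    refine integral_mono hχint (hgint.add hqint) fun z => ?_
    have := hpt (x + √b * z)
    rwa [add_sub_cancel_left] at this
  rw [integral_add hgint hqint] at h1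
  have h2 : ∫ z, (A' * (√b * z) ^ 2 + A' * (√b * z) ^ 4) ∂(gaussianReal 0 1)
      = A' * b + A' * b ^ 2 * m := by
    have e := integral_quartic_gaussianReal 0 0 A' (-A') √b
    simp only [zero_mul, zero_add, add_zero, neg_mul, sub_neg_eq_add] at e
    rw [e, Real.sq_sqrt hb0, ← hm, show √b ^ 4 = (√b ^ 2) ^ 2 by ring, Real.sq_sqrt hb0]
  rw [h2] at h1
  have h3 : A' * b ^ 2 * m ≤ A' * b * m := by
    refine mul_le_mul_of_nonneg_right (mul_le_mul_of_nonneg_left ?_ hA'0) hm0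
    nlinarith
  refine h1.trans ?_
  change heatAverage b g x + _ ≤ _
  have e : A' * (1 + m) * b = A' * b + A' * b * m := by ring
  rw [e]
  linarith

/-- A function dominating its Gaussian averages, and essentially non-decreasing in `s`, is
asymptotically not exceeded at a given point by suitable mollifications: their kernels are
slightly truncated averages of heat kernels. -/
lemma exists_isPastMollifier_mollify_le {W : ℝ × ℝ × ℝ → ℝ} (hW : Measurable W) {K C : ℝ}
    (hC : 0 < C) (hWK : ∀ z, |W z| ≤ K * (2 + |z.2.1|) * (1 + z.2.2 ^ 2))
    (hlow : ∀ s t x, -(C * (1 + |t| + |x|)) ≤ W (s, t, x))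
    (hheat : ∀ h > 0, ∀ s t x, heatAverage h (fun y => W (s, t, y)) x ≤ W (s, t + h, x))
    {s t x : ℝ} (hs : ∀ δ > 0, ∃ θ > 0, ∀ a ∈ Ioo 0 θ, W (s - a, t, x) ≤ W (s, t, x) + δ)
    {δ ε : ℝ} (hδ : 0 < δ) (hε : 0 < ε) :
    ∃ ρ, IsPastMollifier ρ ε ∧ mollify ρ W (s, t, x) ≤ W (s, t, x) + δ := by
  let χ : ContDiffBump (0 : ℝ) := ⟨ε / 2, ε, by positivity, by linarith⟩
  set A := C * (2 + |t| + |x|) with hA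
  have hA0 : 0 ≤ A := by positivity
  set E := 2 * A / χ.rIn ^ 2 * (1 + ∫ z, z ^ 4 ∂(gaussianReal 0 1)) with hE
  have hE0 : 0 ≤ E := mul_nonneg (div_nonneg (by positivity) (sq_nonneg _))
    (add_nonneg zero_le_one (integral_nonneg fun z => by positivity))
  obtain ⟨θ, hθ, hθs⟩ := hs (δ / 2) (half_pos hδ)
  obtain ⟨c₀, hc₀, h2ε, h2θ, h21, h2E⟩ : ∃ c₀ > 0, 2 * c₀ ≤ ε ∧ 2 * c₀ ≤ θ ∧ 2 * c₀ ≤ 1 ∧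
      E * (2 * c₀) ≤ δ / 2 := by
    refine ⟨min (min ε θ) (min 1 (δ / (2 * (E + 1)))) / 2, by positivity, ?_, ?_, ?_, ?_⟩
    · rw [mul_div_cancel₀ _ two_ne_zero]
      exact (min_le_left _ _).trans (min_le_left _ _)
    · rw [mul_div_cancel₀ _ two_ne_zero]
      exact (min_le_left _ _).trans (min_le_right _ _)
    · rw [mul_div_cancel₀ _ two_ne_zero]
      exact (min_le_right _ _).trans (min_le_left _ _)
    · rw [mul_div_cancel₀ _ two_ne_zero]
      have h1 : E * min (min ε θ) (min 1 (δ / (2 * (E + 1)))) ≤ E * (δ / (2 * (E + 1))) :=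
        mul_le_mul_of_nonneg_left ((min_le_right _ _).trans (min_le_right _ _)) hE0
      refine h1.trans ?_
      rw [mul_div_assoc', div_le_div_iff₀ (by positivity) two_pos]
      nlinarith
  let k : ContDiffBump c₀ := ⟨c₀ / 4, c₀ / 2, by positivity, by linarith⟩
  have hk : k.rOut < c₀ := by
    change c₀ / 2 < c₀
    linarith
  have hρ : IsPastMollifier (heatMollifier k χ) ε := isPastMollifier_heatMollifier hk h2ε
  refine ⟨heatMollifier k χ, hρ, ?_⟩
  refine integral_heatMollifier_mul_le hk
    (hρ.integrable_mul (locallyIntegrable_of_abs_le hW hWK) (s, t, x)) fun a ha b hb => ?_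
  set g : ℝ → ℝ := fun y => W (s - a, t - b, y) with hg
  have hgm : Measurable g := hW.comp (by fun_prop)
  have hχg : Measurable fun y => χ (x - y) * g y :=
    (χ.continuous.measurable.comp (by fun_prop)).mul hgm
  have e : ∫ c, heatKernel b c * (χ c * W ((s, t, x) - (a, b, c)))
      = heatAverage b (fun y => χ (x - y) * g y) x := by
    rw [← integral_heatKernel_mul_sub hb.1 hχg]
    simp [hg]
  rw [e]
  have htb : |t - b| ≤ |t| + 1 := by
    refine (abs_sub _ _).trans ?_
    rw [abs_of_pos hb.1]
    linarith [hb.2]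
  have hcut := heatAverage_cutoff_le (χ := χ) hgm (K := K * (2 + |t - b|)) (A := A) (x := x)
    (fun y => hWK (s - a, t - b, y)) hA0 (fun y => by
      refine le_trans (neg_le_neg ?_) (hlow (s - a) (t - b) y)
      have h1 : |y| ≤ |x| + |y - x| := by
        have := abs_add_le x (y - x)
        rwa [add_sub_cancel] at this
      rw [hA, mul_assoc]
      refine mul_le_mul_of_nonneg_left ?_ hC.le
      nlinarith [mul_nonneg (by positivity : 0 ≤ 1 + |t| + |x|) (abs_nonneg (y - x))])
    hb.1.le (hb.2.le.trans h21)
  have h1 := hheat b hb.1 (s - a) (t - b) x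
  rw [sub_add_cancel] at h1
  have h2 := hθs a ⟨ha.1, ha.2.trans_le h2θ⟩
  have h3 : E * b ≤ E * (2 * c₀) := mul_le_mul_of_nonneg_left hb.2.le hE0
  linarith

end HeatMollifier

/-! ### Comparison -/

section Comparison

variable {μ : ℝ → ProbabilityMeasure ℝ} {w : ℝ × ℝ × ℝ → ℝ} {C : ℝ}

/-- Smooth approximate supersolutions: given an interior point, there is a smooth function which is
a supersolution up to an error `η` on `|x| ≤ R`, dominates the boundary datum up to `δ`, and does
not exceed `w` by more than `δ` at the given point. -/
lemma IsViscositySupersolution.exists_smooth_approx (hμ : IsMarginalFamily μ)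
    (hU : PotentialRegular μ) (hw : IsViscositySupersolution μ w) (hC : 0 < C)
    (hwC : ∀ z ∈ domainZ, -(C * (1 + z.2.1 + |z.2.2|)) ≤ w z)
    (hUC : ∀ x, -(C * (1 + |x|)) ≤ potential μ 0 x) {s₁ t₁ x₁ : ℝ} (hs₁ : 0 < s₁) (hs₁1 : s₁ ≤ 1)
    (ht₁ : 0 < t₁) {δ η : ℝ} (hδ : 0 < δ) (hη : 0 < η) (R : ℝ) :
    ∃ φ : ℝ × ℝ × ℝ → ℝ, ContDiff ℝ 2 φ ∧ φ (s₁, t₁, x₁) ≤ w (s₁, t₁, x₁) + δ ∧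
      (∀ s t x, 0 ≤ t → -(C * (3 + t + |x|)) ≤ φ (s, t, x)) ∧
      (∀ s t x, s = 0 ∨ t = 0 → potential μ 0 x - δ ≤ φ (s, t, x)) ∧
      (∀ s t x, 1 / 2 * iteratedDeriv 2 (fun y => φ (s, t, y)) x
        ≤ deriv (fun r => φ (s, r, x)) t) ∧
      ∀ s ∈ Icc (0 : ℝ) 1, ∀ t x, |x| ≤ R →
        potentialDs μ s x - η ≤ deriv (fun r => φ (r, t, x)) s := by
  have hUunif : UniformContinuousOn (fun p : ℝ × ℝ => potentialDs μ p.1 p.2)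
      (Icc 0 1 ×ˢ Icc (-R - 1) (R + 1)) :=
    (isCompact_Icc.prod isCompact_Icc).uniformContinuousOn_of_continuous
      (hU.2.mono (prod_mono_right (subset_univ _)))
  obtain ⟨r, hr, hrU⟩ := Metric.uniformContinuousOn_iff.1 hUunif η hη
  obtain ⟨ε, hε, hε1, hεδ, hεr⟩ : ∃ ε > 0, ε ≤ 1 ∧ ε ≤ δ ∧ ε < r :=
    ⟨min 1 (min δ (r / 2)), by positivity, min_le_left _ _,
      (min_le_right _ _).trans (min_le_left _ _),
      ((min_le_right _ _).trans (min_le_right _ _)).trans_lt (by linarith)⟩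
  set W : ℝ × ℝ × ℝ → ℝ := fun z => pastExtension μ w C z.1 z.2.1 z.2.2 with hW
  have hWm : Measurable W := measurable_pastExtension hμ hw
  have hWK : ∀ z, |W z| ≤ C * (2 + |z.2.1|) * (1 + z.2.2 ^ 2) := fun z =>
    abs_pastExtension_le hC hwC hUC _ _ _
  have hWl := locallyIntegrable_of_abs_le hWm hWK
  have hheat : ∀ h > 0, ∀ s t x, heatAverage h (fun y => W (s, t, y)) x ≤ W (s, t + h, x) :=
    fun h hh s t x => heatAverage_pastExtension_le hμ hw hC hwC hUC hh s t x
  have hmono : ∀ s s', s ≤ s' → ∀ t x, W (s, t, x) - potential μ (unitClamp s) x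
      ≤ W (s', t, x) - potential μ (unitClamp s') x := fun s s' h t x =>
    pastExtension_sub_potential_mono hμ hU hw hC hwC h t x
  have hleft : ∀ δ > 0, ∃ θ > 0, ∀ a ∈ Ioo 0 θ, W (s₁ - a, t₁, x₁) ≤ W (s₁, t₁, x₁) + δ := by
    intro δ hδ
    obtain ⟨θ, hθ, hθU⟩ := Metric.continuousWithinAt_iff.1
      (hU.1 s₁ ⟨hs₁.le, hs₁1⟩ x₁).continuousWithinAt δ hδ
    refine ⟨min θ s₁, lt_min hθ hs₁, fun a ha => ?_⟩
    have ha1 : a < s₁ := ha.2.trans_le (min_le_right _ _)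
    have hmem : s₁ - a ∈ Icc (0 : ℝ) 1 := ⟨by linarith, by linarith [ha.1]⟩
    have h1 := hmono (s₁ - a) s₁ (by linarith [ha.1]) t₁ x₁
    rw [unitClamp_of_mem hmem, unitClamp_of_mem ⟨hs₁.le, hs₁1⟩] at h1
    have h2 := hθU hmem (by
      rw [Real.dist_eq, sub_sub_cancel_left, abs_neg, abs_of_pos ha.1]
      exact ha.2.trans_le (min_le_left _ _))
    rw [Real.dist_eq] at h2
    have h3 := (abs_lt.1 h2).2
    linarith
  obtain ⟨ρ, hρ, hρ1⟩ := exists_isPastMollifier_mollify_le hWm hC hWK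
    (fun s t x => le_pastExtension hC hwC hUC s t x) hheat hleft hδ hε
  refine ⟨mollify ρ W, hρ.contDiff_mollify hWl,
    hρ1.trans (add_le_add_left (pastExtension_le hs₁ hs₁1 ht₁ x₁) δ), fun s t x ht => ?_,
    fun s t x hst => ?_, fun s t x => hρ.iteratedDeriv_mollify_le hWm hC.le hε.le hWK hheat s t x,
    fun s hs t x hx => ?_⟩
  · refine hρ.le_mollify hWl ?_ fun ζ hζ => ?_
    · rw [neg_nonpos]
      positivity
    · obtain ⟨-, h2, h3⟩ := hρ.support ζ hζ
      refine le_trans (neg_le_neg (mul_le_mul_of_nonneg_left ?_ hC.le))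
        (le_pastExtension hC hwC hUC _ _ _)
      have e1 : |t - ζ.2.1| ≤ t + ε := by
        refine (abs_sub _ _).trans ?_
        rw [abs_of_pos h2.1, abs_of_nonneg ht]
        linarith [h2.2]
      have e2 : |x - ζ.2.2| ≤ |x| + ε := (abs_sub _ _).trans (by linarith)
      simp only [Prod.snd_sub, Prod.fst_sub]
      linarith
  · refine hρ.le_mollify hWl (by linarith [potential_nonpos (μ := μ) 0 x]) fun ζ hζ => ?_
    obtain ⟨h1, h2, h3⟩ := hρ.support ζ hζ
    have e1 : W ((s, t, x) - ζ) = potential μ 0 (x - ζ.2.2) := by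
      rcases hst with rfl | rfl
      · exact pastExtension_of_nonpos_left (by simpa using h1.1.le) _ _
      · exact pastExtension_of_nonpos_right _ (by simpa using h2.1.le) _
    have e2 := hμ.abs_potential_sub_le (s := 0) ⟨le_rfl, zero_le_one⟩ x (x - ζ.2.2)
    rw [sub_sub_cancel] at e2
    rw [e1]
    linarith [le_of_abs_le e2]
  · refine hρ.le_deriv_mollify hU hε hWl hmono hs
      (by linarith [hμ.potentialDs_nonpos s x]) (fun r' hr' y hrs hyx => ?_) t
    have hx' := abs_le.1 hx
    have hy' := abs_le.1 hyx
    have h := hrU (r', y) ⟨hr', ⟨by simp only; linarith, by simp only; linarith⟩⟩ (s, x)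
      ⟨hs, ⟨by simp only; linarith, by simp only; linarith⟩⟩ (by
        rw [Prod.dist_eq, Real.dist_eq, Real.dist_eq]
        exact max_lt (hrs.trans_lt hεr) (hyx.trans_lt hεr))
    rw [Real.dist_eq] at h
    have := (abs_lt.1 h).1
    simp only at this
    linarith

end Comparison

theorem mainTheorem3 (μ : ℝ → ProbabilityMeasure ℝ) (hμ : IsMarginalFamily μ)
    (hU : PotentialRegular μ) (v w : ℝ × ℝ × ℝ → ℝ)
    (hv : IsViscositySubsolution μ v) (hw : IsViscositySupersolution μ w)
    (C : ℝ) (hC : 0 < C)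
    (hvC : ∀ z ∈ domainZ, v z ≤ C * (1 + z.2.1 + |z.2.2|))
    (hwC : ∀ z ∈ domainZ, -(C * (1 + z.2.1 + |z.2.2|)) ≤ w z) :
    ∀ z ∈ domainZ, v z ≤ w z := by
  rintro ⟨s₁, t₁, x₁⟩ hz₁
  by_cases hbd : (s₁, t₁, x₁) ∈ parabolicBoundary
  · exact (hv.boundary _ hbd).trans (hw.boundary _ hbd)
  obtain ⟨⟨hs₁, hs₁1⟩, ht₁⟩ := mem_parabolicInterior.1 (show _ ∈ parabolicInterior from ⟨hz₁, hbd⟩)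
  by_contra! hlt
  obtain ⟨m, hm0, hm⟩ := hμ.exists_le_potential_zero
  -- a growth constant that also serves for the boundary datum
  set D := C + m + 1 with hD
  have hD0 : 0 < D := by positivity
  have hCD : ∀ z ∈ domainZ, C * (1 + z.2.1 + |z.2.2|) ≤ D * (1 + z.2.1 + |z.2.2|) := by
    rintro ⟨s, t, x⟩ hz
    have ht := (mem_domainZ.1 hz).2
    exact mul_le_mul_of_nonneg_right (by linarith)
      (by simp only; linarith [abs_nonneg x])
  have hUD : ∀ x, -(D * (1 + |x|)) ≤ potential μ 0 x := by
    intro x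
    have h1 := hm x
    have h2 : 0 ≤ (C + m) * |x| := by positivity
    rw [hD]
    linarith
  set δ := (v (s₁, t₁, x₁) - w (s₁, t₁, x₁)) / 4 with hδ
  have hδ0 : 0 < δ := by
    rw [hδ]
    linarith
  set N := s₁ + 2 * t₁ + t₁ ^ 2 + x₁ ^ 2 with hN
  have hN0 : 0 ≤ N := by positivity
  set κ := δ / (1 + N) with hκ
  have hκ0 : 0 < κ := by positivity
  have hκN : κ * N ≤ δ := by
    rw [hκ, div_mul_eq_mul_div, div_le_iff₀ (by positivity)]
    linarith
  -- outside `[0,1] × [0,R] × [-R,R]` the penalty beats the linear growth of `v` and of `φ`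
  set A := 4 * D + D ^ 2 / κ with hA
  have hA0 : 0 ≤ A := by positivity
  set R := 1 + (2 * D + A) / κ with hR
  have hR1 : 1 ≤ R := by
    have : 0 ≤ (2 * D + A) / κ := by positivity
    linarith
  have hκR : 2 * D + A ≤ κ * R := by
    have : κ * R = κ + (2 * D + A) := by
      rw [hR]
      field_simp
    linarith
  have hcoer1 : ∀ q, R ≤ q → A ≤ κ * q ^ 2 - 2 * D * q := by
    intro q hq
    have h1 : κ * R ≤ κ * q := mul_le_mul_of_nonneg_left hq hκ0.le
    nlinarith
  have hcoer2 : ∀ q, -(D ^ 2 / κ) ≤ κ * q ^ 2 - 2 * D * q := by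
    intro q
    have e : κ * q ^ 2 - 2 * D * q + D ^ 2 / κ = (κ * q - D) ^ 2 / κ := by
      field_simp
      ring
    have : 0 ≤ (κ * q - D) ^ 2 / κ := by positivity
    linarith
  obtain ⟨φ, hφC, hφ1, hφlow, hφbd, hφheat, hφs⟩ := hw.exists_smooth_approx hμ hU hD0
    (fun z hz => (neg_le_neg (hCD z hz)).trans (hwC z hz)) hUD hs₁ hs₁1 ht₁ hδ0 (half_pos hκ0) R
  -- the penalty also makes the test function a strict supersolution
  set Φ : ℝ × ℝ × ℝ → ℝ := fun z =>
    φ z + κ * (z.1 + 2 * z.2.1 + z.2.1 ^ 2 + z.2.2 ^ 2) with hΦ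
  have hΦC : ContDiff ℝ 2 Φ := hφC.add (by fun_prop)
  have hpos : 0 < v (s₁, t₁, x₁) - Φ (s₁, t₁, x₁) := by
    simp only [hΦ, ← hN]
    linarith
  have hout : ∀ s t x, (s, t, x) ∈ domainZ → (R ≤ t ∨ R ≤ |x|) →
      v (s, t, x) - Φ (s, t, x) ≤ 0 := by
    intro s t x hz h
    obtain ⟨⟨hs, -⟩, ht⟩ := mem_domainZ.1 hz
    have h1 := (hvC _ hz).trans (hCD _ hz)
    have h2 := hφlow s t x ht
    have h3 : A - D ^ 2 / κ ≤ (κ * t ^ 2 - 2 * D * t) + (κ * |x| ^ 2 - 2 * D * |x|) := by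
      rcases h with h | h
      · linarith [hcoer1 t h, hcoer2 |x|]
      · linarith [hcoer1 |x| h, hcoer2 t]
    have h4 : 0 ≤ κ * s := by positivity
    have h5 : 0 ≤ κ * (2 * t) := by positivity
    rw [sq_abs] at h3
    simp only [hΦ] at h1 ⊢
    linarith
  set K : Set (ℝ × ℝ × ℝ) := Icc 0 1 ×ˢ Icc 0 R ×ˢ Icc (-R) R with hK
  have hKc : IsCompact K := isCompact_Icc.prod (isCompact_Icc.prod isCompact_Icc)
  have hKZ : K ⊆ domainZ := by
    rintro ⟨s, t, x⟩ ⟨hs, ht, -⟩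
    exact mem_domainZ.2 ⟨hs, ht.1⟩
  have hKout : ∀ z ∈ domainZ, z ∉ K → v z - Φ z ≤ 0 := by
    rintro ⟨s, t, x⟩ hz hzK
    refine hout s t x hz ?_
    by_contra! h
    have h2 := abs_lt.1 h.2
    exact hzK ⟨(mem_domainZ.1 hz).1, ⟨(mem_domainZ.1 hz).2, h.1.le⟩, ⟨h2.1.le, h2.2.le⟩⟩
  have hz₁K : (s₁, t₁, x₁) ∈ K := by
    by_contra h
    exact (hKout _ hz₁ h).not_gt hpos
  obtain ⟨⟨s, t, x⟩, hzK, hzmax⟩ := UpperSemicontinuousOn.exists_isMaxOn (f := fun z => v z - Φ z)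
    ⟨_, hz₁K⟩ hKc (by
      simp only [sub_eq_add_neg]
      exact (hv.usc.mono hKZ).add hΦC.continuous.neg.continuousOn.upperSemicontinuousOn)
  have hzmax := isMaxOn_iff.1 hzmax
  have hzZ := hKZ hzK
  have hzpos := hpos.trans_le (hzmax _ hz₁K)
  have hglobal : IsMaxOn (fun z => v z - Φ z) domainZ (s, t, x) := by
    refine isMaxOn_iff.2 fun z hz => ?_
    by_cases h : z ∈ K
    · exact hzmax z h
    · exact (hKout z hz h).trans hzpos.le
  obtain ⟨⟨hs0, hs1⟩, ht0⟩ := mem_domainZ.1 hzZ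
  -- on the boundary the maximum would be at most `δ`
  by_cases hbd' : (s, t, x) ∈ parabolicBoundary
  · have h1 := hv.boundary _ hbd'
    have h2 := hφbd s t x ((mem_parabolicBoundary hzZ).1 hbd')
    have h3 : 2 * δ ≤ v (s, t, x) - Φ (s, t, x) := by
      refine le_trans ?_ (hzmax _ hz₁K)
      simp only [hΦ, ← hN]
      linarith
    have h4 : 0 ≤ κ * (s + 2 * t + t ^ 2 + x ^ 2) := by positivity
    simp only [hΦ] at h1 h3
    linarith
  have hpde := hv.interior _ ⟨hzZ, hbd'⟩ Φ hΦC.contDiffOn hglobal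
  have hdt : HasDerivAt (fun r => Φ (s, r, x))
      (deriv (fun r => φ (s, r, x)) t + κ * (2 + 2 * t)) t := by
    have h1 := (((hasDerivAt_id t).const_mul 2).const_add s).fun_add ((hasDerivAt_id t).fun_pow 2)
    refine ((hasDerivAt_time_of_contDiff hφC s t x).fun_add
      ((h1.add_const (x ^ 2)).const_mul κ)).congr_deriv ?_
    simp
  have hds : HasDerivAt (fun r => Φ (r, t, x)) (deriv (fun r => φ (r, t, x)) s + κ) s := by
    have h1 := (((hasDerivAt_id s).add_const (2 * t)).add_const (t ^ 2)).add_const (x ^ 2)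
    refine ((hasDerivAt_fst_of_contDiff hφC s t x).fun_add (h1.const_mul κ)).congr_deriv ?_
    simp
  have hdx : iteratedDeriv 2 (fun y => Φ (s, t, y)) x
      = iteratedDeriv 2 (fun y => φ (s, t, y)) x + 2 * κ := by
    have hφx : ContDiff ℝ 2 fun y => φ (s, t, y) := hφC.comp (by fun_prop)
    simp only [hΦ]
    rw [iteratedDeriv_fun_add hφx.contDiffAt (by fun_prop)]
    congr 1
    refine iteratedDeriv_two_eq (g' := fun y => κ * (2 * y)) (fun y => ?_) ?_
    · simpa using ((hasDerivAt_pow 2 y).const_add (s + 2 * t + t ^ 2)).const_mul κ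
    · refine (((hasDerivAt_id x).const_mul (2 : ℝ)).const_mul κ).congr_deriv ?_
      ring
  rw [pdeOperator_eq hzZ hdt hds, hdx] at hpde
  have hheat := hφheat s t x
  have hsx := hφs s ⟨hs0, hs1⟩ t x (abs_le.2 hzK.2.2)
  have hκt : 0 ≤ κ * t := by positivity
  refine hpde.not_gt (lt_min ?_ ?_) <;> linarith
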